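/- **Theorem 4.1 (Linearized Uniqueness).** Let $d\ge 1$, let $\beta,b:\mathbb R\to\mathbb R$ and $D:\mathbb R^d\to\mathbb R^d$ satisfy - (j) $\beta\in C^1(\mathbb R)$, $\beta'(r)\ge 0$ for all $r\in\mathbb R$, and $\beta(0)=0$; - (jj) $D\in L^\infty(\mathbb R^d;\mathbb R^d)$; - (jjj) $b\in C^1(\mathbb R)$; - (jv) for each compact $K\subset\mathbb R$ there is $\alpha_K\in(0,\infty)$ such that $|b'(r)r+b(r)|\le\alpha_K|\beta'(r)|$ for all $r\in K$. Let $T>0$ and $u\in L^\infty((0,T)\times\mathbb R^d)$, and set $\frac{\beta(0)}{0}:=\beta'(0)$. Let $H^{-1}$ be the dual of the Sobolev space $H^1(\mathbb R^d)$, functions in $L^2(\mathbb R^d)$ being identified with elements of $H^{-1}$ through the $L^2$ inner product. Let $y_1,y_2\in L^2((0,T)\times\mathbb R^d)$ be such that $y_1-y_2\in L^\infty(0,T;H^{-1})$, and suppose that, for some signed Borel measure $\rho_0$ of bounded variation on $\mathbb R^d$, both $\rho=y_1$ and $\rho=y_2$ satisfy $$\int_0^T\!\!\int_{\mathbb R^d}\Big(\varphi_t+\frac{\beta(u)}{u}\,\Delta\varphi+b(u)\,D\cdot\nabla\varphi\Big)\rho\,dx\,dt+\int_{\mathbb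 R^d}\varphi(0,x)\,\rho_0(dx)=0\qquad\text{for all }\varphi\in C_0^\infty([0,T)\times\mathbb R^d),$$ where $C_0^\infty([0,T)\times\mathbb R^d)$ is the space of smooth functions with compact support in $[0,T)\times\mathbb R^d$. Suppose moreover that $$\lim_{t\to0}\ \operatorname*{ess\,sup}_{s\in(0,t)}\Big|\int_{\mathbb R^d}(y_1(s,x)-y_2(s,x))\,\varphi(x)\,dx\Big|=0\qquad\text{for all }\varphi\in C_0^\infty(\mathbb R^d).$$ Then $y_1=y_2$ almost everywhere on $(0,T)\times\mathbb R^d$. -/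

import Mathlib

open MeasureTheory Set Filter Topology
open scoped ENNReal ContDiff Gradient Laplacian

namespace FokkerPlanck

/-- The space `ℝ^d` with its Euclidean norm and Lebesgue measure. -/
abbrev Space (d : ℕ) : Type := EuclideanSpace ℝ (Fin d)

/-- The test functions `C_0^∞(ℝ^d)`. -/
def IsTestFunction {d : ℕ} (φ : Space d → ℝ) : Prop :=
  ContDiff ℝ ∞ φ ∧ HasCompactSupport φ

/-- `g` is the gradient of `f` in the sense of distributions on `ℝ^d`:
`∫ f ∇φ dx = - ∫ φ g dx` for all test functions `φ`. -/
def IsWeakGradient {d : ℕ} (f : Space d → ℝ) (g : Space d → Space d) : Prop :=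
  ∀ φ : Space d → ℝ, IsTestFunction φ →
    ∫ x, f x • ∇ φ x = - ∫ x, φ x • g x

theorem IsTestFunction.memLp {d : ℕ} {φ : Space d → ℝ} (hφ : IsTestFunction φ) :
    MemLp φ 2 volume :=
  hφ.1.continuous.memLp_of_hasCompactSupport hφ.2

theorem IsTestFunction.memLp_gradient {d : ℕ} {φ : Space d → ℝ} (hφ : IsTestFunction φ) :
    MemLp (∇ φ) 2 volume := by
  have h : ∇ φ = (InnerProductSpace.toDual ℝ (Space d)).symm ∘ fderiv ℝ φ := rfl
  have hc : Continuous (fderiv ℝ φ) := hφ.1.continuous_fderiv (by simp)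
  rw [h]
  exact ((InnerProductSpace.toDual ℝ (Space d)).symm.continuous.comp hc).memLp_of_hasCompactSupport
    ((hφ.2.fderiv ℝ).comp_left (map_zero _))

theorem integrable_smul_of_memLp {d : ℕ} {F : Type} [NormedAddCommGroup F] [NormedSpace ℝ F]
    {f : Space d → ℝ} {g : Space d → F} (hf : MemLp f 2 volume) (hg : MemLp g 2 volume) :
    Integrable (fun x => f x • g x) volume :=
  memLp_one_iff_integrable.mp (hg.smul hf)

/-- The Sobolev space `H^1(ℝ^d)`: the pairs `(f, ∇f)` with `f ∈ L^2(ℝ^d)` whose distributional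
gradient `∇f` lies in `L^2(ℝ^d; ℝ^d)`.  The `L^2` product norm on the pairs is the usual norm
`(|f|_2^2 + |∇f|_2^2)^{1/2}`. -/
noncomputable def H1 (d : ℕ) :
    Submodule ℝ (WithLp 2 (Lp ℝ 2 (volume : Measure (Space d)) ×
      Lp (Space d) 2 (volume : Measure (Space d)))) where
  carrier := {p | IsWeakGradient p.fst p.snd}
  zero_mem' := by
    intro φ hφ
    have h1 : (fun x => ((0 : Lp ℝ 2 (volume : Measure (Space d))) : Space d → ℝ) x • ∇ φ x)
        =ᵐ[volume] fun _ => 0 := by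
      filter_upwards [Lp.coeFn_zero ℝ 2 (volume : Measure (Space d))] with x hx
      rw [hx, Pi.zero_apply, zero_smul]
    have h2 : (fun x => φ x • ((0 : Lp (Space d) 2 (volume : Measure (Space d))) :
        Space d → Space d) x) =ᵐ[volume] fun _ => 0 := by
      filter_upwards [Lp.coeFn_zero (Space d) 2 (volume : Measure (Space d))] with x hx
      rw [hx, Pi.zero_apply, smul_zero]
    simp only [WithLp.zero_fst, WithLp.zero_snd]
    rw [integral_congr_ae h1, integral_congr_ae h2]
    simp
  add_mem' := by
    intro p q hp hq φ hφ
    have h1 : (fun x => (p.fst + q.fst : Lp ℝ 2 (volume : Measure (Space d))) x • ∇ φ x)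
        =ᵐ[volume] fun x => p.fst x • ∇ φ x + q.fst x • ∇ φ x := by
      filter_upwards [Lp.coeFn_add p.fst q.fst] with x hx
      rw [hx, Pi.add_apply, add_smul]
    have h2 : (fun x => φ x • (p.snd + q.snd : Lp (Space d) 2 (volume : Measure (Space d))) x)
        =ᵐ[volume] fun x => φ x • p.snd x + φ x • q.snd x := by
      filter_upwards [Lp.coeFn_add p.snd q.snd] with x hx
      rw [hx, Pi.add_apply, smul_add]
    simp only [WithLp.add_fst, WithLp.add_snd]
    rw [integral_congr_ae h1, integral_congr_ae h2,
      integral_add (integrable_smul_of_memLp (Lp.memLp _) hφ.memLp_gradient)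
        (integrable_smul_of_memLp (Lp.memLp _) hφ.memLp_gradient),
      integral_add (integrable_smul_of_memLp hφ.memLp (Lp.memLp _))
        (integrable_smul_of_memLp hφ.memLp (Lp.memLp _)), hp φ hφ, hq φ hφ]
    abel
  smul_mem' := by
    intro c p hp φ hφ
    have h1 : (fun x => (c • p.fst : Lp ℝ 2 (volume : Measure (Space d))) x • ∇ φ x)
        =ᵐ[volume] fun x => c • (p.fst x • ∇ φ x) := by
      filter_upwards [Lp.coeFn_smul c p.fst] with x hx
      simp [hx, mul_smul]
    have h2 : (fun x => φ x • (c • p.snd : Lp (Space d) 2 (volume : Measure (Space d))) x)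
        =ᵐ[volume] fun x => c • (φ x • p.snd x) := by
      filter_upwards [Lp.coeFn_smul c p.snd] with x hx
      simp only [hx, Pi.smul_apply]
      rw [smul_comm]
    simp only [WithLp.smul_fst, WithLp.smul_snd]
    rw [integral_congr_ae h1, integral_congr_ae h2, integral_smul, integral_smul, hp φ hφ]
    simp

/-- The space `H^{-1}(ℝ^d)`: the dual of `H^1(ℝ^d)`, with the dual norm. -/
abbrev HNeg1 (d : ℕ) : Type := StrongDual ℝ (H1 d)

/-- Lebesgue measure on `(0,T) × ℝ^d`. -/
noncomputable def cylinderMeasure (d : ℕ) (T : ℝ) : Measure (ℝ × Space d) :=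
  (volume.restrict (Ioo 0 T)).prod volume

/-- `z ∈ L^∞(0,T;H^{-1})`, for a function `z` whose slices `z(t,·)` lie in `L^2(ℝ^d)` for
a.e. `t`: there is an essentially bounded, strongly measurable `Z : (0,T) → H^{-1}` such that for
a.e. `t` the functional `Z t` is the one given by the function `z(t,·)`, that is
`v ↦ (z(t,·), v)_2`. -/
def MemLinftyHNeg1 {d : ℕ} (T : ℝ) (z : ℝ × Space d → ℝ) : Prop :=
  ∃ Z : ℝ → HNeg1 d, MemLp Z ∞ (volume.restrict (Ioo 0 T)) ∧
    ∀ᵐ t ∂(volume.restrict (Ioo 0 T)), ∀ v : H1 d,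
      Z t v = ∫ x, z (t, x) * v.1.fst x

/-- The diffusion coefficient `r ↦ β(r)/r`, with the convention `β(0)/0 := β'(0)`. -/
noncomputable def diffusionCoeff (β : ℝ → ℝ) (r : ℝ) : ℝ :=
  if r = 0 then deriv β 0 else β r / r

/-- `φ ∈ C_0^∞([0,T) × ℝ^d)`.  Such functions are the restrictions to `[0,T) × ℝ^d` of the smooth
functions on `ℝ × ℝ^d` with compact support in `(-∞,T) × ℝ^d`; a function is represented by such an
extension, of which only the values on `[0,T) × ℝ^d` are ever used. -/
def IsSpaceTimeTestFunction {d : ℕ} (T : ℝ) (φ : ℝ × Space d → ℝ) : Prop :=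
  ContDiff ℝ ∞ φ ∧ HasCompactSupport φ ∧ tsupport φ ⊆ Iio T ×ˢ univ

/-- `ρ` is a distributional solution on `(0,T) × ℝ^d`, with the finite signed Borel measure `ρ₀` as
initial datum, of the linear Fokker-Planck equation
`ρ_t - Δ((β(u)/u) ρ) + div(D b(u) ρ) = 0`, that is
`∫∫ (φ_t + (β(u)/u) Δφ + b(u) D·∇φ) ρ dx dt + ∫ φ(0,x) ρ₀(dx) = 0`
for all `φ ∈ C_0^∞([0,T) × ℝ^d)`. -/
def IsLinearizedSolution {d : ℕ} (β b : ℝ → ℝ) (D : Space d → Space d) (T : ℝ)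
    (u : ℝ × Space d → ℝ) (ρ₀ : SignedMeasure (Space d)) (ρ : ℝ × Space d → ℝ) : Prop :=
  ∀ φ : ℝ × Space d → ℝ, IsSpaceTimeTestFunction T φ →
    (∫ p, (deriv (fun s => φ (s, p.2)) p.1
        + diffusionCoeff β (u p) * (Δ (fun x => φ (p.1, x))) p.2
        + b (u p) * inner ℝ (D p.2) (∇ (fun x => φ (p.1, x)) p.2)) * ρ p
      ∂(cylinderMeasure d T))
    + (∫ᵛ x, φ (0, x) ∂•ρ₀) = 0

/-- The initial condition
`lim_{t→0} ess sup_{s∈(0,t)} |(y₁(s) - y₂(s), φ)_2| = 0` for all `φ ∈ C_0^∞(ℝ^d)`. -/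
def SameInitialValue {d : ℕ} (y₁ y₂ : ℝ × Space d → ℝ) : Prop :=
  ∀ φ : Space d → ℝ, IsTestFunction φ →
    Tendsto (fun t : ℝ =>
        essSup (fun s : ℝ => ‖∫ x, (y₁ (s, x) - y₂ (s, x)) * φ x‖ₑ) (volume.restrict (Ioo 0 t)))
      (𝓝[>] 0) (𝓝 0)

end FokkerPlanck

/-!
Put `z = y₁ - y₂`, `a = β(u)/u` and `W = D b(u) z`.  Subtracting the two equations, the initial
datum `ρ₀` drops out, and `z` is a distributional solution of `z_t = Δ(a z) - div W` with
`z(0) = 0`.  Here `0 ≤ a ≤ M`, and integrating the hypothesis `|(r b(r))'| ≤ α β'(r)` gives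
`|b(r)| ≤ α β(r)/r`, hence `|W| ≤ C a |z|`: the drift degenerates at least as fast as the diffusion
(`abs_le_mul_diffusionCoeff`).

Uniqueness is an energy estimate in `H⁻¹`.  Let `R = (1 - Δ)⁻¹`, so that
`⟪z, R z⟫ = |R z|² + |∇R z|²` is the square of the norm of `z` in `H⁻¹`.  Then
`(R z)' = g := (R - 1)(a z) + (∇R)* W`, and
`⟪z, g⟫ = ∫ a z R z - ∫ a z² + ∫ W·∇R z`.  By Young's inequality the dissipation `-∫ a z²` absorbs
the parts of the other two terms that are quadratic in `z`, which leaves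
`2 ⟪z, g⟫ ≤ K ⟪z, R z⟫` (`inner_energy_bound`).  Together with `⟪z, R z⟫(t) = 2 ∫_0^t ⟪z, g⟫`,
Grönwall's lemma gives `⟪z, R z⟫ = 0`, and `z = 0` as `R` is injective.

Three points need an argument.
* The operator `R` is constructed as the continuous extension of `φ - Δφ ↦ φ` from test functions.
  This needs the range of `1 - Δ` on test functions to be dense in `L²`: a function orthogonal to
  it has mollifications `f` with `Δf = f` that vanish at infinity, so `f = 0` by the maximum
  principle (`ae_eq_zero_of_integral_mul_sub_laplacian`).  The same density allows the equation,
  known for test functions only, to be tested with all of `R L²` (`resolvent_weak_identity`).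
* The function `z` is not differentiable in time with values in `L²`; only `R z` is.  The identity
  for `⟪z, R z⟫` is obtained by replacing `R⁻¹` with the bounded operators `(R + λ)⁻¹` and letting
  `λ → 0` (`ae_inner_eq_integral_of_primitive`).
* A function in `L²((0,T) × ℝ^d)` is turned into an `L²(ℝ^d)`-valued function of time, and the weak
  equation into the statement that `R z` is the primitive of `g`
  (`ae_eq_primitive_of_forall_integral_eq_zero`).
-/

namespace FokkerPlanck

/-! ### Calculus of test functions -/

theorem IsTestFunction.fderiv_apply {d : ℕ} {φ : Space d → ℝ} (hφ : IsTestFunction φ)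
    (v : Space d) : IsTestFunction fun x => fderiv ℝ φ x v :=
  ⟨(hφ.1.fderiv_right (m := ∞) (by simp)).clm_apply contDiff_const,
    (hφ.2.fderiv ℝ).comp_left (g := fun L : Space d →L[ℝ] ℝ => L v) rfl⟩

theorem laplacian_eq_sum_fderiv {d : ℕ} {f : Space d → ℝ} (hf : ContDiff ℝ ∞ f) (x : Space d) :
    (Δ f) x = ∑ i, fderiv ℝ (fun y => fderiv ℝ f y (EuclideanSpace.basisFun (Fin d) ℝ i)) x
      (EuclideanSpace.basisFun (Fin d) ℝ i) := by
  rw [InnerProductSpace.laplacian_eq_iteratedFDeriv_orthonormalBasis f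
    (EuclideanSpace.basisFun (Fin d) ℝ)]
  refine Finset.sum_congr rfl fun i _ => ?_
  have h : DifferentiableAt ℝ (fderiv ℝ f) x :=
    ((hf.fderiv_right (m := ∞) (by simp)).differentiable (by simp)) x
  rw [iteratedFDeriv_two_apply, fderiv_clm_apply h (differentiableAt_const _)]
  simp

theorem IsTestFunction.laplacian {d : ℕ} {φ : Space d → ℝ} (hφ : IsTestFunction φ) :
    IsTestFunction (Δ φ) := by
  have h : Δ φ = fun x => ∑ i, fderiv ℝ
      (fun y => fderiv ℝ φ y (EuclideanSpace.basisFun (Fin d) ℝ i)) x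
      (EuclideanSpace.basisFun (Fin d) ℝ i) := funext fun x => laplacian_eq_sum_fderiv hφ.1 x
  refine ⟨?_, ?_⟩
  · rw [h]
    exact ContDiff.sum fun i _ => ((hφ.fderiv_apply _).fderiv_apply _).1
  · refine hφ.2.mono' fun x hx => ?_
    by_contra hx'
    have h0 : φ =ᶠ[𝓝 x] fun _ => 0 := notMem_tsupport_iff_eventuallyEq.mp hx'
    apply hx
    rw [InnerProductSpace.laplacian_congr_nhds h0 |>.self_of_nhds]
    simp

theorem IsTestFunction.add {d : ℕ} {φ ψ : Space d → ℝ} (hφ : IsTestFunction φ)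
    (hψ : IsTestFunction ψ) : IsTestFunction (φ + ψ) :=
  ⟨hφ.1.add hψ.1, hφ.2.add hψ.2⟩

theorem IsTestFunction.const_smul {d : ℕ} {φ : Space d → ℝ} (hφ : IsTestFunction φ) (c : ℝ) :
    IsTestFunction (c • φ) :=
  ⟨contDiff_const.smul hφ.1, hφ.2.smul_left (f := fun _ => c)⟩

theorem IsTestFunction.comp_sub_left {d : ℕ} {φ : Space d → ℝ} (hφ : IsTestFunction φ)
    (x : Space d) : IsTestFunction fun y => φ (x - y) :=
  ⟨hφ.1.comp (contDiff_const.sub contDiff_id),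
    hφ.2.comp_homeomorph (Homeomorph.subLeft x)⟩

theorem fderiv_comp_sub_left {d : ℕ} {φ : Space d → ℝ} (hφ : ContDiff ℝ ∞ φ)
    (x y v : Space d) : fderiv ℝ (fun y => φ (x - y)) y v = - fderiv ℝ φ (x - y) v := by
  have h1 : HasFDerivAt φ (fderiv ℝ φ (x - y)) (x - y) :=
    (hφ.differentiable (by simp) _).hasFDerivAt
  have h2 : HasFDerivAt (fun y => x - y) (-ContinuousLinearMap.id ℝ (Space d)) y :=
    (hasFDerivAt_id y).const_sub x
  have h3 : HasFDerivAt (fun y => φ (x - y)) _ y := h1.comp y h2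
  rw [h3.fderiv]
  simp

theorem IsTestFunction.laplacian_comp_sub_left {d : ℕ} {φ : Space d → ℝ} (hφ : IsTestFunction φ)
    (x y : Space d) : (Δ fun y => φ (x - y)) y = (Δ φ) (x - y) := by
  rw [laplacian_eq_sum_fderiv (hφ.comp_sub_left x).1, laplacian_eq_sum_fderiv hφ.1]
  refine Finset.sum_congr rfl fun i _ => ?_
  have h : (fun y => fderiv ℝ (fun y => φ (x - y)) y (EuclideanSpace.basisFun (Fin d) ℝ i))
      = fun y => -(fun z => fderiv ℝ φ z (EuclideanSpace.basisFun (Fin d) ℝ i)) (x - y) :=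
    funext fun y => fderiv_comp_sub_left hφ.1 x y _
  rw [h, fderiv_fun_neg, neg_apply, fderiv_comp_sub_left (hφ.fderiv_apply _).1]
  simp

theorem IsTestFunction.integrable_mul {d : ℕ} {φ ψ : Space d → ℝ} (hφ : IsTestFunction φ)
    (hψ : IsTestFunction ψ) : Integrable fun x => φ x * ψ x :=
  integrable_smul_of_memLp hφ.memLp hψ.memLp

theorem inner_gradient_eq_sum {d : ℕ} (φ ψ : Space d → ℝ) (x : Space d) :
    inner ℝ (∇ φ x) (∇ ψ x) = ∑ i, fderiv ℝ φ x (EuclideanSpace.basisFun (Fin d) ℝ i)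
      * fderiv ℝ ψ x (EuclideanSpace.basisFun (Fin d) ℝ i) := by
  rw [← (EuclideanSpace.basisFun (Fin d) ℝ).sum_inner_mul_inner]
  simp only [inner_gradient_left, inner_gradient_right]
  simp

/-- Green's formula `∫ φ Δψ = - ∫ ∇φ·∇ψ`. -/
theorem IsTestFunction.integral_mul_laplacian {d : ℕ} {φ ψ : Space d → ℝ} (hφ : IsTestFunction φ)
    (hψ : IsTestFunction ψ) :
    ∫ x, φ x * (Δ ψ) x = - ∫ x, inner ℝ (∇ φ x) (∇ ψ x) := by
  simp only [laplacian_eq_sum_fderiv hψ.1, inner_gradient_eq_sum, Finset.mul_sum]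
  rw [integral_finsetSum _ fun i _ =>
      hφ.integrable_mul ((hψ.fderiv_apply _).fderiv_apply _),
    integral_finsetSum _ fun i _ => (hφ.fderiv_apply _).integrable_mul (hψ.fderiv_apply _),
    ← Finset.sum_neg_distrib]
  refine Finset.sum_congr rfl fun i _ => ?_
  exact integral_mul_fderiv_eq_neg_fderiv_mul_of_integrable
    ((hφ.fderiv_apply _).integrable_mul (hψ.fderiv_apply _))
    (hφ.integrable_mul ((hψ.fderiv_apply _).fderiv_apply _))
    (hφ.integrable_mul (hψ.fderiv_apply _))
    (fun x _ => hφ.1.differentiable (by simp) x)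
    (fun x _ => (hψ.fderiv_apply _).1.differentiable (by simp) x)

/-! ### Density of the range of `1 - Δ` -/

theorem deriv_deriv_nonpos_of_isLocalMax {h : ℝ → ℝ} {s : ℝ} (hc : ContinuousAt h s)
    (hmax : IsLocalMax h s) : deriv (deriv h) s ≤ 0 := by
  by_contra! hpos
  have hmin := isLocalMin_of_deriv_deriv_pos hpos hmax.deriv_eq_zero hc
  -- A local maximum that is also a local minimum makes `h` locally constant.
  have heq : h =ᶠ[𝓝 s] fun _ => h s := by
    filter_upwards [hmax, hmin] with y h1 h2 using le_antisymm h1 h2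
  have h0 : deriv (deriv h) s = 0 := by
    rw [heq.deriv.deriv_eq]
    simp
  exact hpos.ne' h0

theorem laplacian_nonpos_of_isLocalMax {d : ℕ} {f : Space d → ℝ} (hf : ContDiff ℝ ∞ f)
    {x : Space d} (hmax : IsLocalMax f x) : (Δ f) x ≤ 0 := by
  rw [laplacian_eq_sum_fderiv hf]
  refine Finset.sum_nonpos fun i _ => ?_
  set e := EuclideanSpace.basisFun (Fin d) ℝ i
  have hline : ∀ {g : Space d → ℝ}, ContDiff ℝ ∞ g → ∀ s : ℝ,
      HasDerivAt (fun s : ℝ => g (x + s • e)) (fderiv ℝ g (x + s • e) e) s := by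
    intro g hg s
    have h1 : HasFDerivAt g (fderiv ℝ g (x + s • e)) (x + s • e) :=
      (hg.differentiable (by simp) _).hasFDerivAt
    have h2 : HasDerivAt (fun s : ℝ => x + s • e) e s := by
      simpa using ((hasDerivAt_id s).smul_const e).const_add x
    exact h1.comp_hasDerivAt s h2
  have h1 : deriv (fun s : ℝ => f (x + s • e)) = fun s : ℝ => fderiv ℝ f (x + s • e) e :=
    funext fun s => (hline hf s).deriv
  have hf' : ContDiff ℝ ∞ fun y => fderiv ℝ f y e :=
    (hf.fderiv_right (m := ∞) (by simp)).clm_apply contDiff_const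
  have h2 := (hline hf' 0).deriv
  simp only [zero_smul, add_zero] at h2
  rw [← h2, ← h1]
  refine deriv_deriv_nonpos_of_isLocalMax (hline hf 0).continuousAt ?_
  have hcont : Tendsto (fun s : ℝ => x + s • e) (𝓝 0) (𝓝 x) := by
    have : Continuous fun s : ℝ => x + s • e := by fun_prop
    simpa using this.tendsto 0
  have := hcont.eventually hmax
  simpa [IsLocalMax, IsMaxFilter] using this

/-- Maximum principle for `1 - Δ` on `ℝ^d`. -/
theorem nonpos_of_laplacian_eq_self {d : ℕ} {f : Space d → ℝ} (hf : ContDiff ℝ ∞ f)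
    (h0 : Tendsto f (cocompact _) (𝓝 0)) (hΔ : ∀ x, (Δ f) x = f x) (x : Space d) : f x ≤ 0 := by
  by_contra! hx
  obtain ⟨m, hm⟩ := hf.continuous.exists_forall_ge' x
    ((h0.eventually_lt_const hx).mono fun _ h => h.le)
  have h1 := laplacian_nonpos_of_isLocalMax hf (x := m) (Eventually.of_forall hm)
  rw [hΔ] at h1
  linarith [hm x]

section Convolution

open scoped Convolution

theorem contDiff_convolution_testFunction {d : ℕ} {χ η : Space d → ℝ} (hχ : LocallyIntegrable χ)
    (hη : IsTestFunction η) : ContDiff ℝ ∞ (χ ⋆[ContinuousLinearMap.mul ℝ ℝ] η) := by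
  have := hη.2.contDiff_convolution_right (n := ⊤) (ContinuousLinearMap.mul ℝ ℝ) hχ hη.1
  exact this

theorem fderiv_convolution_testFunction {d : ℕ} {χ η : Space d → ℝ} (hχ : LocallyIntegrable χ)
    (hη : IsTestFunction η) (v : Space d) :
    (fun x => fderiv ℝ (χ ⋆[ContinuousLinearMap.mul ℝ ℝ] η) x v)
      = χ ⋆[ContinuousLinearMap.mul ℝ ℝ] fun x => fderiv ℝ η x v := by
  ext x
  rw [(hη.2.hasFDerivAt_convolution_right (ContinuousLinearMap.mul ℝ ℝ) hχ
    (hη.1.of_le (by simp)) x).fderiv, convolution_precompR_apply _ hχ (hη.2.fderiv ℝ)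
    (hη.1.continuous_fderiv (by simp))]

theorem laplacian_convolution_testFunction {d : ℕ} {χ η : Space d → ℝ} (hχ : LocallyIntegrable χ)
    (hη : IsTestFunction η) (x : Space d) :
    (Δ (χ ⋆[ContinuousLinearMap.mul ℝ ℝ] η)) x = ∫ y, χ y * (Δ η) (x - y) := by
  rw [laplacian_eq_sum_fderiv (contDiff_convolution_testFunction hχ hη)]
  simp only [laplacian_eq_sum_fderiv hη.1, Finset.mul_sum]
  rw [integral_finsetSum]
  · refine Finset.sum_congr rfl fun i _ => ?_
    rw [fderiv_convolution_testFunction hχ hη]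
    exact congrFun (fderiv_convolution_testFunction hχ (hη.fderiv_apply _) _) x
  · intro i _
    have hη' := (hη.fderiv_apply (EuclideanSpace.basisFun (Fin d) ℝ i)).fderiv_apply
      (EuclideanSpace.basisFun (Fin d) ℝ i)
    exact hη'.2.convolutionExists_right (ContinuousLinearMap.mul ℝ ℝ) hχ hη'.1.continuous x

theorem abs_integral_mul_le_eLpNorm {d : ℕ} {f g : Space d → ℝ} (hf : MemLp f 2) (hg : MemLp g 2) :
    |∫ x, f x * g x| ≤ (eLpNorm f 2 volume).toReal * (eLpNorm g 2 volume).toReal := by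
  have h := abs_real_inner_le_norm (hg.toLp g) (hf.toLp f)
  rw [Lp.norm_toLp, Lp.norm_toLp, L2.inner_def, mul_comm] at h
  convert h using 2
  refine integral_congr_ae ?_
  filter_upwards [hf.coeFn_toLp, hg.coeFn_toLp] with x h1 h2
  simp [h1, h2]

theorem eLpNorm_comp_sub_left {d : ℕ} (η : Space d → ℝ) (hη : Continuous η) (x : Space d) :
    eLpNorm (fun y => η (x - y)) 2 volume = eLpNorm η 2 volume :=
  eLpNorm_comp_measurePreserving hη.aestronglyMeasurable
    (Measure.measurePreserving_sub_left volume x)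

/-- The mollification of an `L^2` function vanishes at infinity. -/
theorem tendsto_convolution_cocompact {d : ℕ} {χ η : Space d → ℝ} (hχ : MemLp χ 2)
    (hη : IsTestFunction η) :
    Tendsto (χ ⋆[ContinuousLinearMap.mul ℝ ℝ] η) (cocompact _) (𝓝 0) := by
  rw [Metric.tendsto_nhds]
  intro ε hε
  set A := (eLpNorm η 2 volume).toReal
  have hA : 0 ≤ A := ENNReal.toReal_nonneg
  set δ : ℝ := ε / (2 * (A + 1))
  have hδ : 0 < δ := by positivity
  obtain ⟨g, hg1, hg2, hg3, hg4⟩ := hχ.exists_hasCompactSupport_eLpNorm_sub_le (by simp)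
    (ε := ENNReal.ofReal δ) (by simpa using hδ)
  have hcs : HasCompactSupport (g ⋆[ContinuousLinearMap.mul ℝ ℝ] η) :=
    hg1.convolution _ hη.2
  filter_upwards [hcs.isCompact.compl_mem_cocompact] with x hx
  have hgx : (g ⋆[ContinuousLinearMap.mul ℝ ℝ] η) x = 0 := image_eq_zero_of_notMem_tsupport hx
  change ∫ y, g y * η (x - y) = 0 at hgx
  have hηx := (hη.comp_sub_left x).memLp
  have hsub : (χ ⋆[ContinuousLinearMap.mul ℝ ℝ] η) x = ∫ y, (χ - g) y * η (x - y) := by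
    have h1 : Integrable fun y => χ y * η (x - y) := integrable_smul_of_memLp hχ hηx
    have h2 : Integrable fun y => g y * η (x - y) := integrable_smul_of_memLp hg4 hηx
    simp only [Pi.sub_apply, sub_mul]
    rw [integral_sub h1 h2, hgx, sub_zero]
    rfl
  rw [dist_zero_right, Real.norm_eq_abs, hsub]
  have h3 := abs_integral_mul_le_eLpNorm (hχ.sub hg4) hηx
  rw [eLpNorm_comp_sub_left η hη.1.continuous] at h3
  have h4 : (eLpNorm (χ - g) 2 volume).toReal ≤ δ := by
    have := ENNReal.toReal_mono ENNReal.ofReal_ne_top hg2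
    rwa [ENNReal.toReal_ofReal hδ.le] at this
  calc _ ≤ δ * A := h3.trans (by gcongr)
    _ < ε := by
      have : δ * (2 * (A + 1)) = ε := by simp only [δ]; field_simp
      nlinarith

/-- An `L^2` function that is orthogonal to the range of `1 - Δ` vanishes: its mollifications `f`
solve `Δf = f` and vanish at infinity, so they are zero by the maximum principle. -/
theorem ae_eq_zero_of_integral_mul_sub_laplacian {d : ℕ} {χ : Space d → ℝ} (hχ : MemLp χ 2)
    (h : ∀ φ : Space d → ℝ, IsTestFunction φ → ∫ x, χ x * (φ x - (Δ φ) x) = 0) :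
    χ =ᵐ[volume] 0 := by
  have hloc : LocallyIntegrable χ := hχ.locallyIntegrable (by norm_num)
  have hconv : ∀ η : Space d → ℝ, IsTestFunction η → ∀ x,
      (Δ (χ ⋆[ContinuousLinearMap.mul ℝ ℝ] η)) x = (χ ⋆[ContinuousLinearMap.mul ℝ ℝ] η) x := by
    intro η hη x
    have h1 := h _ (hη.comp_sub_left x)
    have hi1 : Integrable fun y => χ y * η (x - y) :=
      integrable_smul_of_memLp hχ (hη.comp_sub_left x).memLp
    have hi2 : Integrable fun y => χ y * (Δ η) (x - y) :=
      integrable_smul_of_memLp hχ (hη.laplacian.comp_sub_left x).memLp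
    simp only [hη.laplacian_comp_sub_left, mul_sub] at h1
    rw [integral_sub hi1 hi2, sub_eq_zero] at h1
    rw [laplacian_convolution_testFunction hloc hη, ← h1]
    rfl
  have hnonpos : ∀ η : Space d → ℝ, IsTestFunction η → ∫ y, χ y * η (0 - y) ≤ 0 := fun η hη =>
    nonpos_of_laplacian_eq_self (contDiff_convolution_testFunction hloc hη)
      (tendsto_convolution_cocompact hχ hη) (hconv η hη) 0
  refine ae_eq_zero_of_integral_contDiff_smul_eq_zero hloc fun η hη1 hη2 => ?_
  have hη : IsTestFunction η := ⟨hη1, hη2⟩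
  have h1 := hnonpos _ (hη.comp_sub_left 0)
  have h2 := hnonpos _ ((hη.const_smul (-1)).comp_sub_left 0)
  simp only [sub_sub_cancel, Pi.smul_apply, smul_eq_mul, neg_mul, one_mul, mul_neg,
    integral_neg] at h1 h2
  simp only [smul_eq_mul, mul_comm (η _)]
  linarith

end Convolution

/-! ### The resolvent `(1 - Δ)⁻¹` on `L^2(ℝ^d)` -/

/-- The space `L^2(ℝ^d)`. -/
abbrev L2 (d : ℕ) : Type := Lp ℝ 2 (volume : Measure (Space d))

/-- The space `L^2(ℝ^d; ℝ^d)`. -/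
abbrev L2Vec (d : ℕ) : Type := Lp (Space d) 2 (volume : Measure (Space d))

/-- The vector space `C_0^∞(ℝ^d)`. -/
def testFunctions (d : ℕ) : Submodule ℝ (Space d → ℝ) where
  carrier := {φ | IsTestFunction φ}
  zero_mem' := ⟨contDiff_const, HasCompactSupport.zero⟩
  add_mem' := IsTestFunction.add
  smul_mem' c _ hφ := hφ.const_smul c

theorem IsTestFunction.sub_laplacian {d : ℕ} {φ : Space d → ℝ} (hφ : IsTestFunction φ) :
    IsTestFunction (φ - Δ φ) := by
  simpa [sub_eq_add_neg] using hφ.add (hφ.laplacian.const_smul (-1))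

theorem IsTestFunction.gradient_add {d : ℕ} {φ ψ : Space d → ℝ} (hφ : IsTestFunction φ)
    (hψ : IsTestFunction ψ) : ∇ (φ + ψ) = ∇ φ + ∇ ψ := by
  ext1 x
  simp only [gradient, Pi.add_apply]
  rw [fderiv_add (hφ.1.differentiable (by simp) x) (hψ.1.differentiable (by simp) x), map_add]

theorem IsTestFunction.gradient_const_smul {d : ℕ} {φ : Space d → ℝ} (hφ : IsTestFunction φ)
    (c : ℝ) : ∇ (c • φ) = c • ∇ φ := by
  ext1 x
  simp only [gradient, Pi.smul_apply]
  rw [fderiv_const_smul (hφ.1.differentiable (by simp) x)]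
  simp

theorem IsTestFunction.sub_laplacian_add {d : ℕ} {φ ψ : Space d → ℝ} (hφ : IsTestFunction φ)
    (hψ : IsTestFunction ψ) : φ + ψ - Δ (φ + ψ) = (φ - Δ φ) + (ψ - Δ ψ) := by
  ext x
  have := ((hφ.1.of_le (m := 2) ENat.LEInfty.out).contDiffAt (x := x)).laplacian_add
    ((hψ.1.of_le (m := 2) ENat.LEInfty.out).contDiffAt)
  simp only [Pi.add_apply, Pi.sub_apply, this]
  ring

theorem IsTestFunction.sub_laplacian_const_smul {d : ℕ} {φ : Space d → ℝ} (hφ : IsTestFunction φ)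
    (c : ℝ) : c • φ - Δ (c • φ) = c • (φ - Δ φ) := by
  ext x
  have := InnerProductSpace.laplacian_smul c
    ((hφ.1.of_le (m := 2) ENat.LEInfty.out).contDiffAt (x := x))
  simp only [Pi.smul_apply, Pi.sub_apply, this, smul_sub]

/-- The inclusion `C_0^∞(ℝ^d) → L^2(ℝ^d)`. -/
noncomputable def testToL2 (d : ℕ) : testFunctions d →ₗ[ℝ] L2 d where
  toFun φ := φ.2.memLp.toLp φ.1
  map_add' _ _ := rfl
  map_smul' _ _ := rfl

/-- The gradient `C_0^∞(ℝ^d) → L^2(ℝ^d; ℝ^d)`. -/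
noncomputable def testGradient (d : ℕ) : testFunctions d →ₗ[ℝ] L2Vec d where
  toFun φ := φ.2.memLp_gradient.toLp (∇ φ.1)
  map_add' φ ψ := by
    rw [← MemLp.toLp_add]
    exact MemLp.toLp_congr _ _ (.of_forall (congrFun (φ.2.gradient_add ψ.2)))
  map_smul' c φ := by
    rw [RingHom.id_apply, ← MemLp.toLp_const_smul]
    exact MemLp.toLp_congr _ _ (.of_forall (congrFun (φ.2.gradient_const_smul c)))

/-- The operator `1 - Δ : C_0^∞(ℝ^d) → L^2(ℝ^d)`. -/
noncomputable def testSubLaplacian (d : ℕ) : testFunctions d →ₗ[ℝ] L2 d where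
  toFun φ := φ.2.sub_laplacian.memLp.toLp (φ.1 - Δ φ.1)
  map_add' φ ψ := by
    rw [← MemLp.toLp_add]
    exact MemLp.toLp_congr _ _ (.of_forall (congrFun (φ.2.sub_laplacian_add ψ.2)))
  map_smul' c φ := by
    rw [RingHom.id_apply, ← MemLp.toLp_const_smul]
    exact MemLp.toLp_congr _ _ (.of_forall (congrFun (φ.2.sub_laplacian_const_smul c)))

theorem coeFn_testToL2 {d : ℕ} (φ : testFunctions d) : testToL2 d φ =ᵐ[volume] φ.1 :=
  φ.2.memLp.coeFn_toLp

theorem coeFn_testGradient {d : ℕ} (φ : testFunctions d) : testGradient d φ =ᵐ[volume] ∇ φ.1 :=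
  φ.2.memLp_gradient.coeFn_toLp

theorem coeFn_testSubLaplacian {d : ℕ} (φ : testFunctions d) :
    testSubLaplacian d φ =ᵐ[volume] φ.1 - Δ φ.1 :=
  φ.2.sub_laplacian.memLp.coeFn_toLp

theorem inner_testToL2 {d : ℕ} (χ : L2 d) (φ : testFunctions d) :
    inner ℝ χ (testToL2 d φ) = ∫ x, χ x * φ.1 x := by
  rw [L2.inner_def]
  refine integral_congr_ae ?_
  filter_upwards [coeFn_testToL2 φ] with x hx
  simp [hx, mul_comm]

theorem inner_testSubLaplacian {d : ℕ} (χ : L2 d) (φ : testFunctions d) :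
    inner ℝ χ (testSubLaplacian d φ) = ∫ x, χ x * (φ.1 x - (Δ φ.1) x) := by
  rw [L2.inner_def]
  refine integral_congr_ae ?_
  filter_upwards [coeFn_testSubLaplacian φ] with x hx
  simp [hx, mul_comm]

theorem inner_testToL2_testSubLaplacian {d : ℕ} (φ ψ : testFunctions d) :
    inner ℝ (testToL2 d φ) (testSubLaplacian d ψ)
      = inner ℝ (testToL2 d φ) (testToL2 d ψ) + inner ℝ (testGradient d φ) (testGradient d ψ) := by
  have h1 : inner ℝ (testGradient d φ) (testGradient d ψ)
      = ∫ x, inner ℝ (∇ φ.1 x) (∇ ψ.1 x) := by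
    rw [L2.inner_def]
    refine integral_congr_ae ?_
    filter_upwards [coeFn_testGradient φ, coeFn_testGradient ψ] with x h h'
    rw [h, h']
  have h2 : ∀ χ : Space d → ℝ, ∫ x, (testToL2 d φ) x * χ x = ∫ x, φ.1 x * χ x := fun χ =>
    integral_congr_ae (by filter_upwards [coeFn_testToL2 φ] with x hx; rw [hx])
  rw [h1, inner_testToL2, inner_testSubLaplacian]
  rw [h2 ψ.1, h2 (fun x => ψ.1 x - (Δ ψ.1 : Space d → ℝ) x)]
  simp only [mul_sub]
  rw [integral_sub (φ.2.integrable_mul ψ.2) (φ.2.integrable_mul ψ.2.laplacian),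
    φ.2.integral_mul_laplacian ψ.2, sub_neg_eq_add]

theorem norm_testToL2_le {d : ℕ} (φ : testFunctions d) :
    ‖testToL2 d φ‖ ≤ 1 * ‖testSubLaplacian d φ‖ := by
  have h := inner_testToL2_testSubLaplacian φ φ
  have h' := real_inner_le_norm (testToL2 d φ) (testSubLaplacian d φ)
  rw [real_inner_self_eq_norm_sq, real_inner_self_eq_norm_sq] at h
  by_contra! hlt
  nlinarith [norm_nonneg (testToL2 d φ), sq_nonneg ‖testGradient d φ‖,
    norm_nonneg (testSubLaplacian d φ)]

theorem norm_testGradient_le {d : ℕ} (φ : testFunctions d) :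
    ‖testGradient d φ‖ ≤ 1 * ‖testSubLaplacian d φ‖ := by
  have h := inner_testToL2_testSubLaplacian φ φ
  have h' := real_inner_le_norm (testToL2 d φ) (testSubLaplacian d φ)
  rw [real_inner_self_eq_norm_sq, real_inner_self_eq_norm_sq] at h
  have h2 := norm_testToL2_le φ
  refine abs_le_of_sq_le_sq' ?_ (by positivity) |>.2
  nlinarith [norm_nonneg (testToL2 d φ), norm_nonneg (testSubLaplacian d φ)]

theorem denseRange_testSubLaplacian (d : ℕ) : DenseRange (testSubLaplacian d) := by
  have h : (LinearMap.range (testSubLaplacian d)).topologicalClosure = ⊤ := by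
    rw [Submodule.topologicalClosure_eq_top_iff, Submodule.eq_bot_iff]
    intro χ hχ
    rw [Submodule.mem_orthogonal'] at hχ
    rw [Lp.eq_zero_iff_ae_eq_zero]
    refine ae_eq_zero_of_integral_mul_sub_laplacian (Lp.memLp χ) fun φ hφ => ?_
    rw [← inner_testSubLaplacian χ ⟨φ, hφ⟩]
    exact hχ _ ⟨_, rfl⟩
  have h' := Submodule.dense_iff_topologicalClosure_eq_top.mpr h
  rwa [LinearMap.coe_range] at h'

/-- The resolvent `R = (1 - Δ)⁻¹` on `L^2(ℝ^d)`: the continuous extension of `φ - Δφ ↦ φ`. -/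
noncomputable def resolvent (d : ℕ) : L2 d →L[ℝ] L2 d :=
  (testToL2 d).extendOfNorm (testSubLaplacian d)

/-- The operator `∇ (1 - Δ)⁻¹` on `L^2(ℝ^d)`: the continuous extension of `φ - Δφ ↦ ∇φ`. -/
noncomputable def resolventGradient (d : ℕ) : L2 d →L[ℝ] L2Vec d :=
  (testGradient d).extendOfNorm (testSubLaplacian d)

theorem resolvent_testSubLaplacian {d : ℕ} (φ : testFunctions d) :
    resolvent d (testSubLaplacian d φ) = testToL2 d φ :=
  LinearMap.extendOfNorm_eq (denseRange_testSubLaplacian d) ⟨1, norm_testToL2_le⟩ φ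

theorem resolventGradient_testSubLaplacian {d : ℕ} (φ : testFunctions d) :
    resolventGradient d (testSubLaplacian d φ) = testGradient d φ :=
  LinearMap.extendOfNorm_eq (denseRange_testSubLaplacian d) ⟨1, norm_testGradient_le⟩ φ

/-- The form `⟪R χ, χ'⟫` is the `H^1` inner product of `R χ` and `R χ'`. -/
theorem inner_resolvent_eq {d : ℕ} (χ χ' : L2 d) :
    inner ℝ (resolvent d χ) χ' = inner ℝ (resolvent d χ) (resolvent d χ')
      + inner ℝ (resolventGradient d χ) (resolventGradient d χ') := by
  refine (denseRange_testSubLaplacian d).induction_on₂ (p := fun χ χ' =>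
    inner ℝ (resolvent d χ) χ' = inner ℝ (resolvent d χ) (resolvent d χ')
      + inner ℝ (resolventGradient d χ) (resolventGradient d χ')) ?_ ?_ χ χ'
  · exact isClosed_eq (by fun_prop) (by fun_prop)
  · intro φ ψ
    simp only [resolvent_testSubLaplacian, resolventGradient_testSubLaplacian]
    exact inner_testToL2_testSubLaplacian φ ψ

theorem isSymmetric_resolvent (d : ℕ) : (resolvent d).toLinearMap.IsSymmetric := by
  intro χ χ'
  change inner ℝ (resolvent d χ) χ' = inner ℝ χ (resolvent d χ')
  rw [real_inner_comm (resolvent d χ') χ, inner_resolvent_eq χ χ', inner_resolvent_eq χ' χ,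
    real_inner_comm (resolvent d χ), real_inner_comm (resolventGradient d χ)]

theorem inner_resolvent_self {d : ℕ} (χ : L2 d) :
    inner ℝ χ (resolvent d χ) = ‖resolvent d χ‖ ^ 2 + ‖resolventGradient d χ‖ ^ 2 := by
  rw [real_inner_comm, inner_resolvent_eq, real_inner_self_eq_norm_sq, real_inner_self_eq_norm_sq]

theorem injective_resolvent (d : ℕ) : Function.Injective (resolvent d) := by
  rw [injective_iff_map_eq_zero]
  intro χ hχ
  rw [Lp.eq_zero_iff_ae_eq_zero]
  refine ae_eq_zero_of_integral_contDiff_smul_eq_zero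
    ((Lp.memLp χ).locallyIntegrable (by norm_num)) fun φ hφ1 hφ2 => ?_
  have h := isSymmetric_resolvent d χ (testSubLaplacian d ⟨φ, hφ1, hφ2⟩)
  simp only [ContinuousLinearMap.coe_coe, hχ, inner_zero_left, resolvent_testSubLaplacian,
    inner_testToL2] at h
  simp only [smul_eq_mul, mul_comm (φ _)]
  exact h.symm

/-! ### Slices of square integrable functions on a product -/

section Slices

variable {α X E : Type*} [MeasurableSpace α] [MeasurableSpace X] {μ : Measure α} {ν : Measure X}

theorem integrable_inner_of_memLp [NormedAddCommGroup E] [InnerProductSpace ℝ E] {f g : X → E}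
    (hf : MemLp f 2 ν) (hg : MemLp g 2 ν) : Integrable (fun x => inner ℝ (f x) (g x)) ν := by
  refine (L2.integrable_inner (𝕜 := ℝ) (hf.toLp f) (hg.toLp g)).congr ?_
  filter_upwards [hf.coeFn_toLp, hg.coeFn_toLp] with x h1 h2
  rw [h1, h2]

theorem memLp_two_smul_prod [NormedAddCommGroup E] [NormedSpace ℝ E] [SFinite μ] [SFinite ν]
    {θ : α → ℝ} {k : X → E} (hθ : MemLp θ 2 μ) (hk : MemLp k 2 ν) :
    MemLp (fun p : α × X => θ p.1 • k p.2) 2 (μ.prod ν) := by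
  have hm : AEStronglyMeasurable (fun p : α × X => θ p.1 • k p.2) (μ.prod ν) :=
    hθ.1.comp_fst.smul hk.1.comp_snd
  rw [memLp_two_iff_integrable_sq_norm hm]
  refine (((memLp_two_iff_integrable_sq_norm hθ.1).mp hθ).mul_prod
    ((memLp_two_iff_integrable_sq_norm hk.1).mp hk)).congr (.of_forall fun p => ?_)
  simp [norm_smul, mul_pow]

open Classical in
/-- The `L^2` class of the slice `f(t, ·)`, or `0` when the slice is not square integrable. -/
noncomputable def sliceL2 [NormedAddCommGroup E] (ν : Measure X) (f : α × X → E) (t : α) :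
    Lp E 2 ν :=
  if h : MemLp (fun x => f (t, x)) 2 ν then h.toLp _ else 0

theorem ae_memLp_slice [NormedAddCommGroup E] [SFinite μ] [SFinite ν] {f : α × X → E}
    (hf : MemLp f 2 (μ.prod ν)) : ∀ᵐ t ∂μ, MemLp (fun x => f (t, x)) 2 ν := by
  have h := (memLp_two_iff_integrable_sq_norm hf.1).mp hf
  filter_upwards [h.prod_right_ae, hf.1.prodMk_left] with t h1 h2
  exact (memLp_two_iff_integrable_sq_norm h2).mpr h1

theorem coeFn_sliceL2 [NormedAddCommGroup E] [SFinite μ] [SFinite ν] {f : α × X → E}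
    (hf : MemLp f 2 (μ.prod ν)) : ∀ᵐ t ∂μ, sliceL2 ν f t =ᵐ[ν] fun x => f (t, x) := by
  filter_upwards [ae_memLp_slice hf] with t ht
  rw [sliceL2, dif_pos ht]
  exact ht.coeFn_toLp

theorem measurable_of_measurable_edist {M : Type*} [PseudoEMetricSpace M]
    [SecondCountableTopology M] [MeasurableSpace M] [BorelSpace M] {F : α → M}
    (h : ∀ c, Measurable fun t => edist (F t) c) : Measurable F := by
  refine measurable_of_isOpen fun U hU => ?_
  -- An open set is a countable union of balls.
  let I : Set (M × ℝ≥0∞) := {q | Metric.eball q.1 q.2 ⊆ U}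
  obtain ⟨S, hSI, hS, hSU⟩ := TopologicalSpace.isOpen_biUnion_countable I
    (fun q => Metric.eball q.1 q.2) fun q _ => Metric.isOpen_eball
  have hU' : U = ⋃ q ∈ S, Metric.eball q.1 q.2 := by
    rw [hSU]
    refine Subset.antisymm (fun x hx => ?_) (iUnion₂_subset fun q hq => hq)
    obtain ⟨ε, hε, hsub⟩ := EMetric.isOpen_iff.mp hU x hx
    exact mem_iUnion₂.mpr ⟨(x, ε), hsub, Metric.mem_eball_self hε⟩
  rw [hU', preimage_iUnion₂]
  exact MeasurableSet.biUnion hS fun q _ => (h q.1) measurableSet_Iio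

variable [NormedAddCommGroup E] [MeasurableSpace E] [BorelSpace E]

theorem measurable_eLpNorm_two_slice [SFinite ν] {f : α × X → E} (hf : Measurable f) :
    Measurable fun t => eLpNorm (fun x => f (t, x)) 2 ν := by
  simp only [eLpNorm_eq_lintegral_rpow_enorm_toReal two_ne_zero ENNReal.ofNat_ne_top]
  exact (Measurable.lintegral_prod_right' (f := fun p => ‖f p‖ₑ ^ (2 : ℝ≥0∞).toReal)
    (hf.enorm.pow_const _)).pow_const _

variable [SecondCountableTopology E]

theorem aestronglyMeasurable_sliceL2 [SFinite μ] [SFinite ν]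
    [SecondCountableTopology (Lp E 2 ν)] {f : α × X → E}
    (hf : AEStronglyMeasurable f (μ.prod ν)) : AEStronglyMeasurable (sliceL2 ν f) μ := by
  borelize ↥(Lp E 2 ν)
  set g := hf.mk f
  have hg : Measurable g := hf.stronglyMeasurable_mk.measurable
  have hslice : ∀ t, AEStronglyMeasurable (fun x => g (t, x)) ν := fun t =>
    (hg.comp measurable_prodMk_left).aestronglyMeasurable
  have hgm : Measurable (sliceL2 ν g) := by
    refine measurable_of_measurable_edist fun c => ?_
    have hset : MeasurableSet {t | MemLp (fun x => g (t, x)) 2 ν} := by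
      have : {t | MemLp (fun x => g (t, x)) 2 ν}
          = (fun t => eLpNorm (fun x => g (t, x)) 2 ν) ⁻¹' Iio ∞ :=
        Set.ext fun t => ⟨fun h => h.2, fun h => ⟨hslice t, h⟩⟩
      rw [this]
      exact measurable_eLpNorm_two_slice hg measurableSet_Iio
    have hc : Measurable (c : X → E) := (Lp.stronglyMeasurable c).measurable
    have hsub : Measurable fun t => eLpNorm (fun x => g (t, x) - c x) 2 ν :=
      measurable_eLpNorm_two_slice (f := fun p => g p - c p.2) (hg.sub (hc.comp measurable_snd))
    classical
    have heq : (fun t => edist (sliceL2 ν g t) c) = fun t =>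
        if MemLp (fun x => g (t, x)) 2 ν then eLpNorm (fun x => g (t, x) - c x) 2 ν
        else edist 0 c := by
      ext t
      by_cases ht : MemLp (fun x => g (t, x)) 2 ν
      · rw [if_pos ht, sliceL2, dif_pos ht, Lp.edist_def]
        refine eLpNorm_congr_ae ?_
        filter_upwards [ht.coeFn_toLp] with x hx
        simp [hx]
      · rw [if_neg ht, sliceL2, dif_neg ht]
    rw [heq]
    exact hsub.ite hset measurable_const
  refine ⟨sliceL2 ν g, hgm.stronglyMeasurable, ?_⟩
  filter_upwards [Measure.ae_ae_of_ae_prod hf.ae_eq_mk] with t ht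
  have hiff := memLp_congr_ae (p := 2) ht
  by_cases h : MemLp (fun x => f (t, x)) 2 ν
  · rw [sliceL2, sliceL2, dif_pos h, dif_pos (hiff.mp h)]
    exact MemLp.toLp_congr _ _ ht
  · rw [sliceL2, sliceL2, dif_neg h, dif_neg (fun h' => h (hiff.mpr h'))]

theorem memLp_sliceL2 [InnerProductSpace ℝ E] [SFinite μ] [SFinite ν]
    [SecondCountableTopology (Lp E 2 ν)] {f : α × X → E}
    (hf : MemLp f 2 (μ.prod ν)) : MemLp (sliceL2 ν f) 2 μ := by
  rw [memLp_two_iff_integrable_sq_norm (aestronglyMeasurable_sliceL2 hf.1)]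
  refine ((memLp_two_iff_integrable_sq_norm hf.1).mp hf).integral_prod_left.congr ?_
  filter_upwards [coeFn_sliceL2 hf] with t ht
  rw [← real_inner_self_eq_norm_sq (sliceL2 ν f t), L2.inner_def]
  refine integral_congr_ae ?_
  filter_upwards [ht] with x hx
  rw [hx, real_inner_self_eq_norm_sq]

/-- Fubini's theorem for the pairing of `f` with a product function `θ(t) k(x)`. -/
theorem integral_smul_inner_prod_eq [InnerProductSpace ℝ E] [CompleteSpace E] [SFinite μ]
    [SFinite ν] [SecondCountableTopology (Lp E 2 ν)] {f : α × X → E} (hf : MemLp f 2 (μ.prod ν))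
    {θ : α → ℝ} (hθ : MemLp θ 2 μ) {k : X → E} (hk : MemLp k 2 ν) :
    ∫ p, θ p.1 * inner ℝ (f p) (k p.2) ∂(μ.prod ν)
      = inner ℝ (hk.toLp k) (∫ t, θ t • sliceL2 ν f t ∂μ) := by
  have hint : Integrable (fun p : α × X => θ p.1 * inner ℝ (f p) (k p.2)) (μ.prod ν) := by
    refine (integrable_inner_of_memLp hf (memLp_two_smul_prod hθ hk)).congr
      (.of_forall fun p => ?_)
    simp [inner_smul_right]
  have hint' : Integrable (fun t => θ t • sliceL2 ν f t) μ :=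
    memLp_one_iff_integrable.mp ((memLp_sliceL2 hf).smul hθ)
  rw [integral_prod _ hint, ← integral_inner hint']
  refine integral_congr_ae ?_
  filter_upwards [coeFn_sliceL2 hf] with t ht
  rw [inner_smul_right, L2.inner_def, integral_const_mul]
  congr 1
  refine integral_congr_ae ?_
  filter_upwards [ht, hk.coeFn_toLp] with x h1 h2
  rw [h1, h2, real_inner_comm]

end Slices

/-! ### Primitives of vector valued functions -/

section Primitives

variable {E F G : Type*} [NormedAddCommGroup E] [NormedSpace ℝ E] [NormedAddCommGroup F]
  [NormedSpace ℝ F] [NormedAddCommGroup G] [NormedSpace ℝ G] [CompleteSpace E] [CompleteSpace F]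
  [CompleteSpace G]

/-- Fubini's theorem on the triangle `{0 < s ≤ t ≤ T}`. -/
theorem integral_bilin_primitive_swap (B : E →L[ℝ] F →L[ℝ] G) {T : ℝ} (hT : 0 ≤ T) {f : ℝ → E}
    {g : ℝ → F} (hf : IntervalIntegrable f volume 0 T) (hg : IntervalIntegrable g volume 0 T) :
    ∫ t in 0..T, B (f t) (∫ s in 0..t, g s) = ∫ s in 0..T, B (∫ t in s..T, f t) (g s) := by
  rw [intervalIntegrable_iff_integrableOn_Ioc_of_le hT] at hf hg
  rw [intervalIntegral.integral_of_le hT, intervalIntegral.integral_of_le hT]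
  set μ : Measure ℝ := volume.restrict (Ioc 0 T)
  have hS : MeasurableSet {p : ℝ × ℝ | p.2 ≤ p.1} := measurableSet_le measurable_snd measurable_fst
  have hf' : Integrable f μ := hf
  have hfg : Integrable (fun p : ℝ × ℝ => B (f p.1) (g p.2)) (μ.prod μ) :=
    hf'.op_fst_snd (by fun_prop) ⟨‖B‖, B.le_opNorm₂⟩ hg
  have hint : Integrable ({p : ℝ × ℝ | p.2 ≤ p.1}.indicator fun p => B (f p.1) (g p.2))
      (μ.prod μ) := hfg.indicator hS
  have hswap := integral_integral_swap (f := fun t s =>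
    {p : ℝ × ℝ | p.2 ≤ p.1}.indicator (fun p => B (f p.1) (g p.2)) (t, s)) hint
  have hL : ∀ t ∈ Ioc 0 T, B (f t) (∫ s in 0..t, g s)
      = ∫ s, {p : ℝ × ℝ | p.2 ≤ p.1}.indicator (fun p => B (f p.1) (g p.2)) (t, s) ∂μ := by
    intro t ht
    have h1 : (fun s => {p : ℝ × ℝ | p.2 ≤ p.1}.indicator (fun p => B (f p.1) (g p.2)) (t, s))
        = (Iic t).indicator fun s => B (f t) (g s) := by
      ext s
      by_cases hs : s ≤ t <;> simp [indicator, hs]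
    have h2 : Ioc 0 T ∩ Iic t = Ioc 0 t := by
      ext s; simp only [mem_inter_iff, mem_Ioc, mem_Iic]; have := ht.2; grind
    rw [h1, integral_indicator measurableSet_Iic, Measure.restrict_restrict measurableSet_Iic,
      inter_comm, h2, intervalIntegral.integral_of_le ht.1.le]
    exact ((B (f t)).integral_comp_comm (hg.mono_set (Ioc_subset_Ioc_right ht.2))).symm
  have hR : ∀ s ∈ Ioc 0 T, B (∫ t in s..T, f t) (g s)
      = ∫ t, {p : ℝ × ℝ | p.2 ≤ p.1}.indicator (fun p => B (f p.1) (g p.2)) (t, s) ∂μ := by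
    intro s hs
    have h1 : (fun t => {p : ℝ × ℝ | p.2 ≤ p.1}.indicator (fun p => B (f p.1) (g p.2)) (t, s))
        = (Ici s).indicator fun t => B (f t) (g s) := by
      ext t
      by_cases ht : s ≤ t <;> simp [indicator, ht]
    have h2 : Ioc 0 T ∩ Ici s = Icc s T := by
      ext t; simp only [mem_inter_iff, mem_Ioc, mem_Icc, mem_Ici]; have := hs.1; grind
    rw [h1, integral_indicator measurableSet_Ici, Measure.restrict_restrict measurableSet_Ici,
      inter_comm, h2, integral_Icc_eq_integral_Ioc, intervalIntegral.integral_of_le hs.2]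
    exact ((B.flip (g s)).integral_comp_comm (hf.mono_set (Ioc_subset_Ioc_left hs.1.le))).symm
  rw [setIntegral_congr_fun measurableSet_Ioc hL, setIntegral_congr_fun measurableSet_Ioc hR]
  exact hswap

/-- Fundamental lemma of the calculus of variations on `(0,T)`: if `q` is the distributional
derivative of `p` and `p` has initial value `0` in the weak sense, then `p` is a.e. the primitive
of `q`. -/
theorem ae_eq_primitive_of_forall_integral_eq_zero {T : ℝ} (hT : 0 < T) {p q : ℝ → E}
    (hp : IntegrableOn p (Ioo 0 T)) (hq : IntegrableOn q (Ioo 0 T))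
    (h : ∀ θ : ℝ → ℝ, ContDiff ℝ ∞ θ → HasCompactSupport θ → tsupport θ ⊆ Iio T →
      ∫ t in Ioo 0 T, (deriv θ t • p t + θ t • q t) = 0) :
    ∀ᵐ t ∂(volume.restrict (Ioo 0 T)), p t = ∫ s in 0..t, q s := by
  have hqi : IntervalIntegrable q volume 0 T := by
    rwa [intervalIntegrable_iff_integrableOn_Ioo_of_le hT.le]
  have hQc : ContinuousOn (fun t => ∫ s in 0..t, q s) (Icc 0 T) := by
    have := intervalIntegral.continuousOn_primitive_interval' hqi left_mem_uIcc
    rwa [uIcc_of_le hT.le] at this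
  have hQi : IntegrableOn (fun t => ∫ s in 0..t, q s) (Ioo 0 T) :=
    (hQc.integrableOn_compact isCompact_Icc).mono_set Ioo_subset_Icc_self
  have hpQ : Integrable (fun t => p t - ∫ s in 0..t, q s) (volume.restrict (Ioo 0 T)) :=
    hp.sub hQi
  have key := isOpen_Ioo.ae_eq_zero_of_integral_contDiff_smul_eq_zero (U := Ioo 0 T)
    (hpQ.locallyIntegrable.locallyIntegrableOn _) fun η hη hηc hηs => ?_
  · filter_upwards [key, ae_restrict_mem measurableSet_Ioo] with t h1 h2
    exact sub_eq_zero.mp (h1 h2)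
  -- `θ(t) = κ(t) ∫_T^t η`, where the cutoff `κ` equals `1` on `[0,∞)`, is a test function with
  -- `θ' = η` on `(0,T)`.
  set ϑ : ℝ → ℝ := fun t => ∫ s in T..t, η s
  have hϑd : ∀ t, HasDerivAt ϑ (η t) t := fun t =>
    intervalIntegral.integral_hasDerivAt_right (hη.continuous.intervalIntegrable _ _)
      (hη.continuous.stronglyMeasurableAtFilter _ _) hη.continuous.continuousAt
  have hϑ : ContDiff ℝ ∞ ϑ := by
    rw [contDiff_infty_iff_deriv]
    refine ⟨fun t => (hϑd t).differentiableAt, ?_⟩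
    rwa [show deriv ϑ = η from funext fun t => (hϑd t).deriv]
  set κ : ℝ → ℝ := fun t => Real.smoothTransition (t + 1)
  have hκ : ContDiff ℝ ∞ κ := Real.smoothTransition.contDiff.comp (contDiff_id.add contDiff_const)
  obtain ⟨b, hbT, hb⟩ : ∃ b < T, ∀ t, b < t → η t = 0 := by
    rcases (tsupport η).eq_empty_or_nonempty with hemp | hne
    · refine ⟨T - 1, by linarith, fun t _ => image_eq_zero_of_notMem_tsupport ?_⟩
      rw [hemp]
      exact notMem_empty _
    · obtain ⟨b, hb1, hb2⟩ := hηc.isCompact.exists_isGreatest hne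
      exact ⟨b, (hηs hb1).2, fun t ht => image_eq_zero_of_notMem_tsupport fun h' =>
        absurd (hb2 h') (not_le.mpr ht)⟩
  have hϑ0 : ∀ t, b ≤ t → ϑ t = 0 := by
    intro t ht
    refine intervalIntegral.integral_zero_ae (.of_forall fun s hs => hb s ?_)
    have := hs.1
    rcases le_total T t with h' | h'
    · rw [min_eq_left h'] at this; linarith
    · rw [min_eq_right h'] at this; linarith
  have hsupp : tsupport (fun t => κ t * ϑ t) ⊆ Icc (-1) b := by
    refine closure_minimal (fun t ht => ?_) isClosed_Icc
    rw [Function.mem_support] at ht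
    constructor
    · by_contra! h'
      exact ht (by simp [κ, Real.smoothTransition.zero_of_nonpos (by linarith : t + 1 ≤ 0)])
    · by_contra! h'
      exact ht (by simp [hϑ0 t h'.le])
  have hcs : HasCompactSupport fun t => κ t * ϑ t :=
    isCompact_Icc.of_isClosed_subset (isClosed_tsupport _) hsupp
  have hθ := h (fun t => κ t * ϑ t) (hκ.mul hϑ) hcs
    (hsupp.trans fun t ht => lt_of_le_of_lt ht.2 hbT)
  have hκ1 : ∀ t, 0 < t → κ =ᶠ[𝓝 t] fun _ => 1 := fun t ht => by
    filter_upwards [lt_mem_nhds ht] with s hs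
    exact Real.smoothTransition.one_of_one_le (by linarith)
  have hθ' : ∫ t in Ioo 0 T, (η t • p t + ϑ t • q t) = 0 := by
    rw [← hθ]
    refine setIntegral_congr_fun measurableSet_Ioo fun t ht => ?_
    have h1 : (fun t => κ t * ϑ t) =ᶠ[𝓝 t] ϑ := by
      filter_upwards [hκ1 t ht.1] with s hs
      rw [hs, one_mul]
    rw [h1.deriv_eq, (hϑd t).deriv, (hκ1 t ht.1).self_of_nhds, one_mul]
  obtain ⟨C, hC⟩ := hηc.exists_bound_of_continuous hη.continuous
  have hηp : IntegrableOn (fun t => η t • p t) (Ioo 0 T) :=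
    hp.bdd_smul C hη.continuous.aestronglyMeasurable (.of_forall hC)
  have hηQ : IntegrableOn (fun t => η t • ∫ s in 0..t, q s) (Ioo 0 T) :=
    hQi.bdd_smul C hη.continuous.aestronglyMeasurable (.of_forall hC)
  have hϑq : IntegrableOn (fun t => ϑ t • q t) (Ioo 0 T) := by
    obtain ⟨C', hC'⟩ := (isCompact_Icc (a := (0 : ℝ)) (b := T)).exists_bound_of_continuousOn
      hϑ.continuous.continuousOn
    exact hq.bdd_smul C' hϑ.continuous.aestronglyMeasurable
      ((ae_restrict_mem measurableSet_Ioo).mono fun t ht => hC' t (Ioo_subset_Icc_self ht))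
  have hswap := integral_bilin_primitive_swap (ContinuousLinearMap.lsmul ℝ ℝ (E := E)) hT.le
    (hη.continuous.intervalIntegrable 0 T) hqi
  have hneg : ∀ s, ∫ t in s..T, η t = -ϑ s := fun s => intervalIntegral.integral_symm _ _
  simp only [ContinuousLinearMap.lsmul_apply, hneg, neg_smul, intervalIntegral.integral_neg] at hswap
  rw [intervalIntegral.integral_of_le hT.le, intervalIntegral.integral_of_le hT.le,
    integral_Ioc_eq_integral_Ioo, integral_Ioc_eq_integral_Ioo] at hswap
  simp only [smul_sub]
  rw [integral_sub hηp hηQ, hswap, sub_neg_eq_add, ← integral_add hηp hϑq, hθ']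

end Primitives

/-! ### An energy identity in Hilbert spaces -/

section Energy

variable {H : Type*} [NormedAddCommGroup H] [InnerProductSpace ℝ H] [CompleteSpace H]

theorem inner_primitive_eq {S : H →L[ℝ] H} (hS : S.toLinearMap.IsSymmetric) {t : ℝ} (ht : 0 ≤ t)
    {g : ℝ → H} (hg : IntervalIntegrable g volume 0 t) :
    inner ℝ (S (∫ s in 0..t, g s)) (∫ s in 0..t, g s)
      = 2 * ∫ s in 0..t, inner ℝ (S (∫ r in 0..s, g r)) (g s) := by
  have hswap := integral_bilin_primitive_swap ((innerSL ℝ).comp S) ht hg hg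
  simp only [ContinuousLinearMap.comp_apply, innerSL_apply_apply] at hswap
  have hVc : ContinuousOn (fun s => S (∫ r in 0..s, g r)) (uIcc 0 t) :=
    S.continuous.comp_continuousOn
      (intervalIntegral.continuousOn_primitive_interval' hg left_mem_uIcc)
  have hVg : IntervalIntegrable (fun s => inner ℝ (S (∫ r in 0..s, g r)) (g s)) volume 0 t := by
    obtain ⟨C, hC⟩ := isCompact_uIcc.exists_bound_of_continuousOn hVc
    rw [uIcc_of_le ht] at hVc hC
    rw [intervalIntegrable_iff_integrableOn_Ioc_of_le ht] at hg ⊢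
    refine (hg.norm.const_mul C).mono'
      (((hVc.mono Ioc_subset_Icc_self).aestronglyMeasurable measurableSet_Ioc).inner hg.1) ?_
    filter_upwards [ae_restrict_mem measurableSet_Ioc] with s hs
    refine (norm_inner_le_norm _ _).trans ?_
    gcongr
    exact hC s (Ioc_subset_Icc_self hs)
  have hgV : ∀ s, inner ℝ (S (g s)) (∫ r in 0..s, g r) = inner ℝ (S (∫ r in 0..s, g r)) (g s) :=
    fun s => by
      rw [real_inner_comm]
      exact (hS _ _).symm
  have hR : ∫ s in 0..t, inner ℝ (S (∫ r in s..t, g r)) (g s)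
      = ∫ s in 0..t, (inner ℝ (S (∫ r in 0..t, g r)) (g s)
        - inner ℝ (S (∫ r in 0..s, g r)) (g s)) := by
    refine intervalIntegral.integral_congr fun s hs => ?_
    have hs0 : IntervalIntegrable g volume 0 s := hg.mono_set (uIcc_subset_uIcc_left hs)
    rw [← intervalIntegral.integral_interval_sub_left hg hs0, map_sub, inner_sub_left]
  have hc : ∫ s in 0..t, inner ℝ (S (∫ r in 0..t, g r)) (g s)
      = inner ℝ (S (∫ r in 0..t, g r)) (∫ s in 0..t, g s) :=
    (innerSL ℝ (S (∫ r in 0..t, g r))).intervalIntegral_comp_comm hg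
  have hci : IntervalIntegrable (fun s => inner ℝ (S (∫ r in 0..t, g r)) (g s)) volume 0 t :=
    ⟨hg.1.const_inner _, hg.2.const_inner _⟩
  simp only [hgV] at hswap
  rw [hR, intervalIntegral.integral_sub hci hVg, hc] at hswap
  linarith

/-- For a positive injective operator `R`, the bounded symmetric operators `S = (R + λ)⁻¹`, with
`λ → 0`, are approximate inverses of `R`. -/
theorem exists_approximate_inverse {R : H →L[ℝ] H} (hR : R.toLinearMap.IsSymmetric)
    (hpos : ∀ x, 0 ≤ inner ℝ (R x) x) (hinj : Function.Injective R) :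
    ∃ S : ℕ → H →L[ℝ] H, (∀ n, (S n).toLinearMap.IsSymmetric) ∧
      (∀ n x, ‖S n (R x)‖ ≤ 2 * ‖x‖) ∧ ∀ x, Tendsto (fun n => S n (R x)) atTop (𝓝 x) := by
  have hex : ∀ c : ℝ, 0 < c → ∃ S : H →L[ℝ] H, (∀ x, R (S x) + c • S x = x) ∧
      ∀ x, S (R x) + c • S x = x := by
    intro c hc
    have hcoer : IsCoercive ((innerSL ℝ).comp (R + c • ContinuousLinearMap.id ℝ H)) := by
      refine ⟨c, hc, fun x => ?_⟩
      simp only [ContinuousLinearMap.comp_apply, innerSL_apply_apply, add_apply,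
        FunLike.coe_smul, Pi.smul_apply, ContinuousLinearMap.id_apply, inner_add_left,
        real_inner_smul_left, real_inner_self_eq_norm_mul_norm]
      linarith [hpos x]
    set e := hcoer.continuousLinearEquivOfBilin
    have he : ∀ x, e x = R x + c • x := by
      intro x
      refine (hcoer.unique_continuousLinearEquivOfBilin fun w => ?_).symm
      rfl
    refine ⟨e.symm, fun x => ?_, fun x => ?_⟩
    · rw [← he]
      exact e.apply_symm_apply x
    · rw [← map_smul, ← map_add, ← he]
      exact e.symm_apply_apply x
  set c : ℕ → ℝ := fun n => 1 / ((n : ℝ) + 1)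
  have hc : ∀ n, 0 < c n := fun n => Nat.one_div_pos_of_nat
  choose S hS1 hS2 using fun n => hex (c n) (hc n)
  have hnorm : ∀ n x, ‖c n • S n x‖ ≤ ‖x‖ := by
    intro n x
    have h1 : c n * ‖S n x‖ ^ 2 ≤ ‖x‖ * ‖S n x‖ := by
      have h2 := real_inner_le_norm x (S n x)
      have h3 := hpos (S n x)
      nth_rw 1 [← hS1 n x] at h2
      rw [inner_add_left, real_inner_smul_left, real_inner_self_eq_norm_sq] at h2
      linarith
    rw [norm_smul, Real.norm_eq_abs, abs_of_pos (hc n)]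
    rcases (norm_nonneg (S n x)).eq_or_lt with h0 | h0
    · rw [← h0]; simp
    · exact le_of_mul_le_mul_right (by linarith) h0
  have heq : ∀ n x, S n (R x) = x - c n • S n x := fun n x => eq_sub_of_add_eq (hS2 n x)
  have hbd : ∀ n x, ‖S n (R x)‖ ≤ 2 * ‖x‖ := by
    intro n x
    rw [heq]
    linarith [norm_sub_le x (c n • S n x), hnorm n x]
  refine ⟨S, fun n x y => ?_, hbd, fun x => ?_⟩
  · have h1 := hR (S n x) (S n y)
    simp only [ContinuousLinearMap.coe_coe] at h1 ⊢
    nth_rw 1 [← hS1 n y]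
    nth_rw 2 [← hS1 n x]
    rw [inner_add_right, inner_add_left, real_inner_smul_left, real_inner_smul_right, h1]
  · -- `c n • S n y → 0` holds on the dense range of `R`, hence everywhere.
    have hdense : DenseRange R := by
      have h : (LinearMap.range R.toLinearMap).topologicalClosure = ⊤ := by
        rw [Submodule.topologicalClosure_eq_top_iff, Submodule.eq_bot_iff]
        intro y hy
        rw [Submodule.mem_orthogonal'] at hy
        have h1 : inner ℝ (R y) (R y) = 0 := by
          rw [← hy (R (R y)) ⟨_, rfl⟩]
          exact hR y (R y)
        exact hinj (by rw [inner_self_eq_zero.mp h1, map_zero])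
      have h' := Submodule.dense_iff_topologicalClosure_eq_top.mpr h
      rwa [LinearMap.coe_range] at h'
    have h0 : Tendsto (fun n => c n • S n x) atTop (𝓝 0) := by
      rw [Metric.tendsto_atTop]
      intro ε hε
      obtain ⟨y, hy⟩ := hdense.exists_dist_lt x (half_pos hε)
      have hlim : Tendsto (fun n => c n * (2 * ‖y‖)) atTop (𝓝 0) := by
        rw [← zero_mul (2 * ‖y‖)]
        exact tendsto_one_div_add_atTop_nhds_zero_nat.mul_const (2 * ‖y‖)
      obtain ⟨N, hN⟩ := eventually_atTop.mp (hlim.eventually_lt_const (half_pos hε))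
      refine ⟨N, fun n hn => ?_⟩
      rw [dist_zero_right]
      have h1 : c n • S n x = c n • S n (x - R y) + c n • S n (R y) := by
        rw [map_sub, smul_sub, sub_add_cancel]
      have h2 : ‖c n • S n (R y)‖ ≤ c n * (2 * ‖y‖) := by
        rw [norm_smul, Real.norm_eq_abs, abs_of_pos (hc n)]
        exact mul_le_mul_of_nonneg_left (hbd n y) (hc n).le
      rw [dist_eq_norm] at hy
      rw [h1]
      linarith [norm_add_le (c n • S n (x - R y)) (c n • S n (R y)), hnorm n (x - R y), hN n hn]
    simp only [heq]
    simpa using h0.const_sub x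

/-- The energy identity of Lions: if `R z` is the primitive of `g`, then
`⟪z(t), R z(t)⟫ = 2 ∫_0^t ⟪z, g⟫`, although `z` itself need not be differentiable in `H`.  It is
the limit of the identity for `⟪S R z, R z⟫`, where `S` approximates `R⁻¹`. -/
theorem ae_inner_eq_integral_of_primitive {R : H →L[ℝ] H} (hR : R.toLinearMap.IsSymmetric)
    (hpos : ∀ x, 0 ≤ inner ℝ (R x) x) (hinj : Function.Injective R) {T : ℝ} {z g : ℝ → H}
    (hz : MemLp z 2 (volume.restrict (Ioo 0 T))) (hg : MemLp g 2 (volume.restrict (Ioo 0 T)))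
    (h : ∀ᵐ t ∂(volume.restrict (Ioo 0 T)), R (z t) = ∫ s in 0..t, g s) :
    ∀ᵐ t ∂(volume.restrict (Ioo 0 T)),
      inner ℝ (z t) (R (z t)) = 2 * ∫ s in 0..t, inner ℝ (z s) (g s) := by
  obtain ⟨S, hS1, hS2, hS3⟩ := exists_approximate_inverse hR hpos hinj
  have hgi : IntegrableOn g (Ioo 0 T) := hg.integrable (by norm_num)
  have hzg : IntegrableOn (fun s => 2 * (‖z s‖ * ‖g s‖)) (Ioo 0 T) :=
    (hz.norm.integrable_mul hg.norm).const_mul 2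
  filter_upwards [h, ae_restrict_mem measurableSet_Ioo] with t ht htT
  have hsub : Ioc 0 t ⊆ Ioo 0 T := fun s hs => ⟨hs.1, hs.2.trans_lt htT.2⟩
  have hgt : IntervalIntegrable g volume 0 t := by
    rw [intervalIntegrable_iff_integrableOn_Ioc_of_le htT.1.le]
    exact hgi.mono_set hsub
  have hres : ∀ᵐ s ∂(volume.restrict (Ioc 0 t)), R (z s) = ∫ r in 0..s, g r :=
    ae_restrict_of_ae_restrict_of_subset hsub h
  have hn : ∀ n, inner ℝ (S n (R (z t))) (R (z t))
      = 2 * ∫ s in 0..t, inner ℝ (S n (R (z s))) (g s) := by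
    intro n
    rw [ht, inner_primitive_eq (hS1 n) htT.1.le hgt, intervalIntegral.integral_of_le htT.1.le,
      intervalIntegral.integral_of_le htT.1.le]
    congr 1
    refine integral_congr_ae ?_
    filter_upwards [hres] with s hs
    rw [hs]
  have hlim1 : Tendsto (fun n => inner ℝ (S n (R (z t))) (R (z t))) atTop
      (𝓝 (inner ℝ (z t) (R (z t)))) := (hS3 (z t)).inner tendsto_const_nhds
  have hlim2 : Tendsto (fun n => ∫ s in 0..t, inner ℝ (S n (R (z s))) (g s)) atTop
      (𝓝 (∫ s in 0..t, inner ℝ (z s) (g s))) := by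
    simp only [intervalIntegral.integral_of_le htT.1.le]
    refine tendsto_integral_of_dominated_convergence (fun s => 2 * (‖z s‖ * ‖g s‖)) (fun n => ?_)
      (hzg.mono_set hsub) (fun n => .of_forall fun s => ?_) (.of_forall fun s => ?_)
    · have hm := (((S n).comp R).continuous.comp_aestronglyMeasurable hz.1).inner hg.1 (𝕜 := ℝ)
      exact hm.mono_measure (Measure.restrict_mono hsub le_rfl)
    · refine (norm_inner_le_norm _ _).trans ?_
      rw [← mul_assoc]
      gcongr
      exact hS2 n _
    · exact (hS3 (z s)).inner tendsto_const_nhds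
  refine tendsto_nhds_unique hlim1 ?_
  simp only [hn]
  exact hlim2.const_mul 2

/-- Grönwall's lemma for a continuous function bounded by a multiple of its primitive. -/
theorem nonpos_of_le_integral {T K : ℝ} (hT : 0 < T) (hK : 0 ≤ K) {φ : ℝ → ℝ}
    (hφ : ContinuousOn φ (Icc 0 T)) (h : ∀ t ∈ Icc 0 T, φ t ≤ K * ∫ s in 0..t, φ s) :
    ∀ t ∈ Icc 0 T, φ t ≤ 0 := by
  have hd : ∀ t ∈ Ico 0 T, HasDerivWithinAt (fun t => ∫ s in 0..t, φ s) (φ t) (Ici t) t := by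
    intro t ht
    have hint : IntervalIntegrable φ volume 0 t :=
      (hφ.mono (Icc_subset_Icc_right ht.2.le)).intervalIntegrable_of_Icc ht.1
    have hmem : Icc 0 T ∈ 𝓝[>] t :=
      mem_of_superset (Ioo_mem_nhdsGT ht.2) fun s hs => ⟨ht.1.trans hs.1.le, hs.2.le⟩
    refine intervalIntegral.integral_hasDerivWithinAt_right hint (s := Ici t) (t := Ioi t) ?_ ?_
    · exact ⟨Icc 0 T, hmem, hφ.aestronglyMeasurable measurableSet_Icc⟩
    · exact (hφ t ⟨ht.1, ht.2.le⟩).mono_of_mem_nhdsWithin hmem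
  have hc : ContinuousOn (fun t => ∫ s in 0..t, φ s) (Icc 0 T) := by
    have := intervalIntegral.continuousOn_primitive_interval'
      (hφ.intervalIntegrable_of_Icc (μ := volume) hT.le) left_mem_uIcc
    rwa [uIcc_of_le hT.le] at this
  intro t ht
  have hG := le_gronwallBound_of_liminf_deriv_right_le hc
    (fun x hx r hr => (hd x hx).liminf_right_slope_le hr) (δ := 0) (by simp)
    (fun x hx => (h x ⟨hx.1, hx.2.le⟩).trans_eq (add_zero _).symm) t ht
  rw [gronwallBound_ε0_δ0] at hG
  exact (h t ht).trans (mul_nonpos_of_nonneg_of_nonpos hK hG)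

/-- Uniqueness for `(R z)' = g`, `z(0) = 0`, under a one-sided bound of `⟪z, g⟫` by the energy
`⟪z, R z⟫`. -/
theorem ae_eq_zero_of_primitive {R : H →L[ℝ] H} (hR : R.toLinearMap.IsSymmetric)
    (hpos : ∀ x, ‖R x‖ ^ 2 ≤ inner ℝ (R x) x) (hinj : Function.Injective R) {T K : ℝ} (hT : 0 < T)
    (hK : 0 ≤ K) {z g : ℝ → H} (hz : MemLp z 2 (volume.restrict (Ioo 0 T)))
    (hg : MemLp g 2 (volume.restrict (Ioo 0 T)))
    (h : ∀ᵐ t ∂(volume.restrict (Ioo 0 T)), R (z t) = ∫ s in 0..t, g s)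
    (hbound : ∀ᵐ t ∂(volume.restrict (Ioo 0 T)),
      2 * inner ℝ (z t) (g t) ≤ K * inner ℝ (z t) (R (z t))) :
    ∀ᵐ t ∂(volume.restrict (Ioo 0 T)), z t = 0 := by
  have henergy := ae_inner_eq_integral_of_primitive hR
    (fun x => (sq_nonneg _).trans (hpos x)) hinj hz hg h
  have hzg : IntegrableOn (fun s => inner ℝ (z s) (g s)) (Ioo 0 T) :=
    integrable_inner_of_memLp hz hg
  have hzgi : IntervalIntegrable (fun s => inner ℝ (z s) (g s)) volume 0 T := by
    rwa [intervalIntegrable_iff_integrableOn_Ioo_of_le hT.le]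
  have hc : ContinuousOn (fun t => 2 * ∫ s in 0..t, inner ℝ (z s) (g s)) (Icc 0 T) := by
    have := intervalIntegral.continuousOn_primitive_interval' hzgi left_mem_uIcc
    rw [uIcc_of_le hT.le] at this
    exact continuousOn_const.mul this
  have hle := nonpos_of_le_integral hT hK hc fun t ht => by
    rw [← intervalIntegral.integral_const_mul, ← intervalIntegral.integral_const_mul]
    refine intervalIntegral.integral_mono_ae_restrict ht.1
      ((hzgi.mono_set (by
        rw [uIcc_of_le ht.1, uIcc_of_le hT.le]; exact Icc_subset_Icc_right ht.2)).const_mul 2)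
      (((hc.mono (Icc_subset_Icc_right ht.2)).intervalIntegrable_of_Icc ht.1).const_mul K) ?_
    rw [← Measure.restrict_congr_set (Ioo_ae_eq_Icc (μ := volume))]
    have hsub : Ioo 0 t ⊆ Ioo 0 T := Ioo_subset_Ioo_right ht.2
    filter_upwards [ae_restrict_of_ae_restrict_of_subset hsub hbound,
      ae_restrict_of_ae_restrict_of_subset hsub henergy] with s h1 h2
    rwa [h2] at h1
  filter_upwards [henergy, ae_restrict_mem measurableSet_Ioo] with t h1 htT
  have h0 : inner ℝ (z t) (R (z t)) ≤ 0 := h1.le.trans (hle t (Ioo_subset_Icc_self htT))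
  have h3 := hpos (z t)
  rw [real_inner_comm] at h3
  have h4 : ‖R (z t)‖ = 0 := pow_eq_zero_iff two_ne_zero |>.mp
    (le_antisymm (h3.trans h0) (sq_nonneg _))
  exact hinj (by rw [norm_eq_zero.mp h4, map_zero])

end Energy

/-! ### Uniqueness for a degenerate linear equation with dominated drift -/

theorem toLp_laplacian_eq {d : ℕ} (φ : testFunctions d) :
    φ.2.laplacian.memLp.toLp (Δ φ.1) = testToL2 d φ - testSubLaplacian d φ := by
  refine Lp.ext ?_
  filter_upwards [φ.2.laplacian.memLp.coeFn_toLp, coeFn_testToL2 φ, coeFn_testSubLaplacian φ,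
    Lp.coeFn_sub (testToL2 d φ) (testSubLaplacian d φ)] with x h1 h2 h3 h4
  rw [h1, h4, Pi.sub_apply, h2, h3, Pi.sub_apply, sub_sub_cancel]

/-- If `Z + Δ A - div W = 0` when paired with test functions, then applying `R = (1 - Δ)⁻¹` gives
an identity in `L^2`: with `∇*` the adjoint of `∇`, `R Δ = R - 1` and `R ∇* = (∇ R)*`. -/
theorem resolvent_weak_identity {d : ℕ} {Z A : L2 d} {W : L2Vec d}
    (h : ∀ φ : testFunctions d, inner ℝ (testToL2 d φ) Z
      + inner ℝ (testToL2 d φ - testSubLaplacian d φ) A + inner ℝ (testGradient d φ) W = 0) :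
    resolvent d Z + (resolvent d A - A + ContinuousLinearMap.adjoint (resolventGradient d) W)
      = 0 := by
  have hχ : ∀ χ : L2 d, inner ℝ (resolvent d χ) Z + inner ℝ (resolvent d χ - χ) A
      + inner ℝ (resolventGradient d χ) W = 0 := by
    intro χ
    refine (denseRange_testSubLaplacian d).induction_on (p := fun χ =>
      inner ℝ (resolvent d χ) Z + inner ℝ (resolvent d χ - χ) A
        + inner ℝ (resolventGradient d χ) W = 0) χ (isClosed_eq (by fun_prop) (by fun_prop)) ?_
    intro φ
    rw [resolvent_testSubLaplacian, resolventGradient_testSubLaplacian]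
    exact h φ
  refine ext_inner_left ℝ fun χ => ?_
  have hs : ∀ Y, inner ℝ χ (resolvent d Y) = inner ℝ (resolvent d χ) Y := fun Y =>
    (isSymmetric_resolvent d χ Y).symm
  rw [inner_zero_right, ← hχ χ, inner_add_right, inner_add_right, inner_sub_right,
    ContinuousLinearMap.adjoint_inner_right, hs, hs, inner_sub_left]
  ring

/-- The dissipation `-∫ a z²` absorbs the drift, because `|W| ≤ C a |z|`. -/
theorem pointwise_energy_bound {d : ℕ} {a z r M C : ℝ} {p W : Space d} (ha : 0 ≤ a) (haM : a ≤ M)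
    (hW : ‖W‖ ≤ C * a * |z|) :
    r * (a * z) - z * (a * z) + inner ℝ p W ≤ M * (1 + C ^ 2) / 2 * (r ^ 2 + ‖p‖ ^ 2) := by
  have h1 : inner ℝ p W ≤ ‖p‖ * (C * a * |z|) :=
    (real_inner_le_norm p W).trans (by gcongr)
  have h2 : r * (a * z) - z * (a * z) + ‖p‖ * (C * a * |z|)
      ≤ a * ((r ^ 2 + C ^ 2 * ‖p‖ ^ 2) / 2) := by
    have h3 := sq_nonneg (r - z)
    have h4 := sq_nonneg (C * ‖p‖ - |z|)
    have h5 := sq_abs z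
    have h6 : r * z - z ^ 2 + ‖p‖ * (C * |z|) ≤ (r ^ 2 + C ^ 2 * ‖p‖ ^ 2) / 2 := by nlinarith
    calc _ = a * (r * z - z ^ 2 + ‖p‖ * (C * |z|)) := by ring
      _ ≤ _ := by gcongr
  have h7 : a * ((r ^ 2 + C ^ 2 * ‖p‖ ^ 2) / 2) ≤ M * ((1 + C ^ 2) * (r ^ 2 + ‖p‖ ^ 2) / 2) := by
    have : r ^ 2 + C ^ 2 * ‖p‖ ^ 2 ≤ (1 + C ^ 2) * (r ^ 2 + ‖p‖ ^ 2) := by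
      nlinarith [sq_nonneg (C * r), sq_nonneg ‖p‖]
    have hM : 0 ≤ M := ha.trans haM
    gcongr
  linarith

theorem inner_energy_bound {d : ℕ} {a : Space d → ℝ} {Z A : L2 d} {W : L2Vec d} {M C : ℝ}
    (ha : ∀ᵐ x, 0 ≤ a x ∧ a x ≤ M) (hA : ∀ᵐ x, A x = a x * Z x)
    (hW : ∀ᵐ x, ‖W x‖ ≤ C * a x * |Z x|) :
    2 * inner ℝ Z (resolvent d A - A + ContinuousLinearMap.adjoint (resolventGradient d) W)
      ≤ M * (1 + C ^ 2) * inner ℝ Z (resolvent d Z) := by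
  set r := resolvent d Z
  set p := resolventGradient d Z
  have hs : inner ℝ Z (resolvent d A) = inner ℝ r A := (isSymmetric_resolvent d Z A).symm
  rw [inner_resolvent_self, inner_add_right, inner_sub_right, hs,
    ContinuousLinearMap.adjoint_inner_right]
  change 2 * (inner ℝ r A - inner ℝ Z A + inner ℝ p W) ≤ M * (1 + C ^ 2) * (‖r‖ ^ 2 + ‖p‖ ^ 2)
  have hi1 := L2.integrable_inner (𝕜 := ℝ) r A
  have hi2 := L2.integrable_inner (𝕜 := ℝ) Z A
  have hi12 : Integrable fun x => inner ℝ (r x) (A x) - inner ℝ (Z x) (A x) := hi1.sub hi2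
  have hi3 := L2.integrable_inner (𝕜 := ℝ) p W
  have hi4 := L2.integrable_inner (𝕜 := ℝ) r r
  have hi5 := L2.integrable_inner (𝕜 := ℝ) p p
  have hle : inner ℝ r A - inner ℝ Z A + inner ℝ p W
      ≤ M * (1 + C ^ 2) / 2 * (inner ℝ r r + inner ℝ p p) := by
    rw [L2.inner_def, L2.inner_def, L2.inner_def, L2.inner_def, L2.inner_def,
      ← integral_sub hi1 hi2, ← integral_add hi12 hi3, ← integral_add hi4 hi5,
      ← integral_const_mul]
    refine integral_mono_ae (hi12.add hi3) ((hi4.add hi5).const_mul _) ?_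
    filter_upwards [ha, hA, hW] with x h1 h2 h3
    have h4 := pointwise_energy_bound (r := r x) (p := p x) h1.1 h1.2 h3
    have h5 : ∀ s t : ℝ, inner ℝ s t = s * t := fun s t => by simp [mul_comm]
    simp only [h5, h2, real_inner_self_eq_norm_sq]
    rw [← sq]
    exact h4
  rw [real_inner_self_eq_norm_sq, real_inner_self_eq_norm_sq] at hle
  linarith

/-- Uniqueness for `z_t - Δ(a z) + div W = 0`, `z(0) = 0`, with `a` nonnegative and bounded and
`|W| ≤ C a |z|`. -/
theorem ae_eq_zero_of_weak_equation {d : ℕ} {T : ℝ} (hT : 0 < T) {a z : ℝ × Space d → ℝ}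
    {W : ℝ × Space d → Space d} {M C : ℝ}
    (hz : MemLp z 2 (cylinderMeasure d T))
    (haz : MemLp (fun p => a p * z p) 2 (cylinderMeasure d T))
    (hW : MemLp W 2 (cylinderMeasure d T))
    (ha : ∀ᵐ p ∂(cylinderMeasure d T), 0 ≤ a p ∧ a p ≤ M)
    (hWa : ∀ᵐ p ∂(cylinderMeasure d T), ‖W p‖ ≤ C * a p * |z p|)
    (heq : ∀ θ : ℝ → ℝ, ContDiff ℝ ∞ θ → HasCompactSupport θ → tsupport θ ⊆ Iio T →
      ∀ φ : Space d → ℝ, IsTestFunction φ →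
        (∫ p, deriv θ p.1 * inner ℝ (z p) (φ p.2) ∂(cylinderMeasure d T))
        + (∫ p, θ p.1 * inner ℝ (a p * z p) ((Δ φ : Space d → ℝ) p.2) ∂(cylinderMeasure d T))
        + (∫ p, θ p.1 * inner ℝ (W p) (∇ φ p.2) ∂(cylinderMeasure d T)) = 0) :
    z =ᵐ[cylinderMeasure d T] 0 := by
  by_cases hM : M < 0
  · -- The bounds `0 ≤ a ≤ M` are then contradictory, so the measure vanishes.
    filter_upwards [ha] with p hp
    linarith [hp.1, hp.2]
  rw [not_lt] at hM
  rw [cylinderMeasure] at *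
  have : Fact ((2 : ℝ≥0∞) ≠ ⊤) := ⟨ENNReal.ofNat_ne_top⟩
  set μ : Measure ℝ := volume.restrict (Ioo 0 T)
  set Z : ℝ → L2 d := sliceL2 volume z
  set A : ℝ → L2 d := sliceL2 volume fun p => a p * z p
  set V : ℝ → L2Vec d := sliceL2 volume W
  set P' := ContinuousLinearMap.adjoint (resolventGradient d)
  have hZ : MemLp Z 2 μ := memLp_sliceL2 hz
  have hA : MemLp A 2 μ := memLp_sliceL2 haz
  have hV : MemLp V 2 μ := memLp_sliceL2 hW
  set g : ℝ → L2 d := fun t => resolvent d (A t) - A t + P' (V t)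
  have hg : MemLp g 2 μ :=
    (((resolvent d).comp_memLp' hA).sub hA).add (P'.comp_memLp' hV)
  have hRZ : MemLp (fun t => resolvent d (Z t)) 2 μ := (resolvent d).comp_memLp' hZ
  have hbdd : ∀ {θ : ℝ → ℝ}, Continuous θ → HasCompactSupport θ → MemLp θ 2 μ :=
    fun hc hs => hc.memLp_of_hasCompactSupport hs
  have hsmul : ∀ {E : Type} [NormedAddCommGroup E] [NormedSpace ℝ E] {θ : ℝ → ℝ} {F : ℝ → E},
      MemLp θ 2 μ → MemLp F 2 μ → Integrable (fun t => θ t • F t) μ := fun hθ hF =>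
    memLp_one_iff_integrable.mp (hF.smul hθ)
  have hprim : ∀ᵐ t ∂μ, resolvent d (Z t) = ∫ s in 0..t, g s := by
    refine ae_eq_primitive_of_forall_integral_eq_zero hT (hRZ.integrable (by norm_num))
      (hg.integrable (by norm_num)) fun θ hθ hθc hθs => ?_
    have hθ2 : MemLp θ 2 μ := hbdd hθ.continuous hθc
    have hθ2' : MemLp (deriv θ) 2 μ := hbdd (hθ.continuous_deriv (by simp)) hθc.deriv
    have hid := resolvent_weak_identity (Z := ∫ t, deriv θ t • Z t ∂μ)
      (A := ∫ t, θ t • A t ∂μ) (W := ∫ t, θ t • V t ∂μ) fun φ => by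
        have h1 := heq θ hθ hθc hθs φ.1 φ.2
        rw [integral_smul_inner_prod_eq hz hθ2' φ.2.memLp,
          integral_smul_inner_prod_eq haz hθ2 φ.2.laplacian.memLp,
          integral_smul_inner_prod_eq hW hθ2 φ.2.memLp_gradient, toLp_laplacian_eq] at h1
        exact h1
    have hi1 := hsmul hθ2' hRZ
    have hi2 := hsmul hθ2 hg
    have hRA : MemLp (fun t => resolvent d (A t)) 2 μ := (resolvent d).comp_memLp' hA
    have hPV : MemLp (fun t => P' (V t)) 2 μ := P'.comp_memLp' hV
    have hi3 := hsmul hθ2 hRA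
    have hi4 := hsmul hθ2 hA
    have hi34 : Integrable (fun t => θ t • resolvent d (A t) - θ t • A t) μ := hi3.sub hi4
    have hi5 := hsmul hθ2 hPV
    rw [← ContinuousLinearMap.integral_comp_comm _ (hsmul hθ2' hZ),
      ← ContinuousLinearMap.integral_comp_comm _ (hsmul hθ2 hA),
      ← ContinuousLinearMap.integral_comp_comm _ (hsmul hθ2 hV)] at hid
    simp only [map_smul] at hid
    rw [← integral_sub hi3 hi4, ← integral_add hi34 hi5] at hid
    rw [integral_add hi1 hi2, ← hid]
    simp only [g, smul_add, smul_sub]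
  have hbound : ∀ᵐ t ∂μ, 2 * inner ℝ (Z t) (g t)
      ≤ M * (1 + C ^ 2) * inner ℝ (Z t) (resolvent d (Z t)) := by
    filter_upwards [coeFn_sliceL2 hz, coeFn_sliceL2 haz, coeFn_sliceL2 hW,
      Measure.ae_ae_of_ae_prod ha, Measure.ae_ae_of_ae_prod hWa] with t h1 h2 h3 h4 h5
    refine inner_energy_bound (a := fun x => a (t, x)) h4 ?_ ?_
    · filter_upwards [h1, h2] with x e1 e2
      rw [e1, e2]
    · filter_upwards [h1, h3, h5] with x e1 e2 e3
      rwa [e1, e2]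
  have hzero := ae_eq_zero_of_primitive (isSymmetric_resolvent d)
    (fun x => by
      rw [real_inner_comm, inner_resolvent_self]
      exact le_add_of_nonneg_right (sq_nonneg _))
    (injective_resolvent d) hT (by positivity) hZ hg hprim hbound
  refine hz.1.ae_eq_mk.trans ?_
  have hm : MeasurableSet {p | hz.1.mk z p = 0} :=
    hz.1.stronglyMeasurable_mk.measurable (measurableSet_singleton 0)
  refine (Measure.ae_prod_iff_ae_ae hm).mpr ?_
  filter_upwards [hzero, coeFn_sliceL2 hz, Measure.ae_ae_of_ae_prod hz.1.ae_eq_mk]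
    with t h1 h2 h3
  have h4 : Z t =ᵐ[volume] 0 := Lp.eq_zero_iff_ae_eq_zero.mp h1
  filter_upwards [h2, h3, h4] with x e1 e2 e3
  rw [← e2, ← e1]
  exact e3

/-! ### Bounds on the coefficients -/

theorem continuous_diffusionCoeff {β : ℝ → ℝ} (hβ : ContDiff ℝ 1 β) (hβ0 : β 0 = 0) :
    Continuous (diffusionCoeff β) := by
  have h : diffusionCoeff β = dslope β 0 := by
    ext r
    rcases eq_or_ne r 0 with rfl | hr
    · simp [diffusionCoeff]
    · rw [diffusionCoeff, if_neg hr, dslope_of_ne _ hr, slope_def_field, hβ0, sub_zero, sub_zero]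
  rw [h, ← continuousOn_univ]
  exact (continuousOn_dslope univ_mem).mpr
    ⟨hβ.continuous.continuousOn, hβ.differentiable one_ne_zero 0⟩

theorem diffusionCoeff_nonneg {β : ℝ → ℝ} (hβ : ContDiff ℝ 1 β) (hβ' : ∀ r, 0 ≤ deriv β r)
    (hβ0 : β 0 = 0) (r : ℝ) : 0 ≤ diffusionCoeff β r := by
  have hmono : Monotone β := monotone_of_deriv_nonneg (hβ.differentiable one_ne_zero) hβ'
  rw [diffusionCoeff]
  split_ifs with hr
  · exact hβ' 0
  · rcases le_total 0 r with h | h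
    · exact div_nonneg (hβ0 ▸ hmono h) h
    · exact div_nonneg_of_nonpos (hβ0 ▸ hmono h) h

/-- The bound `|(r b(r))'| ≤ α β'(r)` integrates to `|b(r)| ≤ α β(r)/r`. -/
theorem abs_le_mul_diffusionCoeff {β b : ℝ → ℝ} (hβ : ContDiff ℝ 1 β)
    (hβ' : ∀ r, 0 ≤ deriv β r) (hβ0 : β 0 = 0) (hb : ContDiff ℝ 1 b) {m α : ℝ} (hm : 0 ≤ m)
    (hbβ : ∀ r ∈ Icc (-m) m, |deriv b r * r + b r| ≤ α * |deriv β r|) {r : ℝ}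
    (hr : r ∈ Icc (-m) m) : |b r| ≤ α * diffusionCoeff β r := by
  have hmono : ∀ σ : ℝ, |σ| = 1 → MonotoneOn (fun r => α * β r + σ * (b r * r)) (Icc (-m) m) := by
    intro σ hσ
    have hd : ∀ r, HasDerivAt (fun r => α * β r + σ * (b r * r))
        (α * deriv β r + σ * (deriv b r * r + b r * 1)) r := fun r =>
      ((hβ.differentiable one_ne_zero r).hasDerivAt.const_mul α).add
        (((hb.differentiable one_ne_zero r).hasDerivAt.mul (hasDerivAt_id r)).const_mul σ)
    refine monotoneOn_of_deriv_nonneg (convex_Icc _ _)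
      (fun r _ => (hd r).continuousAt.continuousWithinAt)
      (fun r _ => (hd r).differentiableAt.differentiableWithinAt) fun r hr => ?_
    rw [(hd r).deriv, mul_one]
    have h1 := hbβ r (interior_subset hr)
    rw [abs_of_nonneg (hβ' r)] at h1
    have h2 : |σ * (deriv b r * r + b r)| ≤ α * deriv β r := by rwa [abs_mul, hσ, one_mul]
    linarith [neg_abs_le (σ * (deriv b r * r + b r))]
  have h0 : (0 : ℝ) ∈ Icc (-m) m := ⟨by linarith, hm⟩
  rcases lt_trichotomy r 0 with hneg | rfl | hpos
  · have h1 := hmono 1 (by simp) hr h0 hneg.le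
    have h2 := hmono (-1) (by simp) hr h0 hneg.le
    simp only [hβ0, mul_zero, add_zero] at h1 h2
    rw [diffusionCoeff, if_neg hneg.ne, ← mul_div_assoc, le_div_iff_of_neg hneg,
      ← neg_neg r, mul_neg, ← abs_of_neg hneg, ← abs_mul]
    have : |b r * r| ≤ -(α * β r) := abs_le.mpr ⟨by linarith, by linarith⟩
    rw [abs_of_neg hneg, neg_neg]
    linarith
  · have := hbβ 0 h0
    rw [mul_zero, zero_add, abs_of_nonneg (hβ' 0)] at this
    simpa [diffusionCoeff] using this
  · have h1 := hmono 1 (by simp) h0 hr hpos.le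
    have h2 := hmono (-1) (by simp) h0 hr hpos.le
    simp only [hβ0, mul_zero, add_zero] at h1 h2
    rw [diffusionCoeff, if_neg hpos.ne', ← mul_div_assoc, le_div_iff₀ hpos]
    nth_rw 2 [← abs_of_pos hpos]
    rw [← abs_mul]
    exact abs_le.mpr ⟨by linarith, by linarith⟩

theorem ae_norm_le_of_memLp_top {α E : Type*} [MeasurableSpace α] {μ : Measure α}
    [NormedAddCommGroup E] {f : α → E} (hf : MemLp f ⊤ μ) :
    ∃ m : ℝ, 0 ≤ m ∧ ∀ᵐ x ∂μ, ‖f x‖ ≤ m := by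
  refine ⟨(eLpNorm f ⊤ μ).toReal, ENNReal.toReal_nonneg, ?_⟩
  have h := ae_le_eLpNormEssSup (f := f) (μ := μ)
  filter_upwards [h] with x hx
  rw [← eLpNorm_exponent_top] at hx
  rw [← toReal_enorm]
  exact ENNReal.toReal_mono hf.2.ne hx

/-! ### Product test functions -/

theorem isSpaceTimeTestFunction_mul {d : ℕ} {T : ℝ} {θ : ℝ → ℝ} (hθ : ContDiff ℝ ∞ θ)
    (hθc : HasCompactSupport θ) (hθs : tsupport θ ⊆ Iio T) {φ : Space d → ℝ}
    (hφ : IsTestFunction φ) : IsSpaceTimeTestFunction T fun p : ℝ × Space d => θ p.1 * φ p.2 := by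
  have hsupp : tsupport (fun p : ℝ × Space d => θ p.1 * φ p.2) ⊆ tsupport θ ×ˢ tsupport φ := by
    refine closure_minimal (fun p hp => ?_)
      ((isClosed_tsupport θ).prod (isClosed_tsupport φ))
    rw [Function.mem_support] at hp
    exact ⟨subset_tsupport θ (left_ne_zero_of_mul hp), subset_tsupport φ (right_ne_zero_of_mul hp)⟩
  refine ⟨(hθ.comp contDiff_fst).mul (hφ.1.comp contDiff_snd), ?_, fun p hp => ?_⟩
  · exact (hθc.isCompact.prod hφ.2.isCompact).of_isClosed_subset (isClosed_tsupport _) hsupp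
  · exact ⟨hθs (hsupp hp).1, mem_univ _⟩

theorem IsTestFunction.laplacian_const_mul {d : ℕ} {φ : Space d → ℝ} (hφ : IsTestFunction φ)
    (c : ℝ) (x : Space d) : (Δ fun x => c * φ x) x = c * (Δ φ) x :=
  InnerProductSpace.laplacian_smul c
    ((hφ.1.of_le (m := 2) ENat.LEInfty.out).contDiffAt (x := x))

theorem IsTestFunction.gradient_const_mul {d : ℕ} {φ : Space d → ℝ} (hφ : IsTestFunction φ)
    (c : ℝ) (x : Space d) : ∇ (fun x => c * φ x) x = c • ∇ φ x :=
  congrFun (hφ.gradient_const_smul c) x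

/-! ### Uniqueness for the linearized Fokker-Planck equation -/

/-- Two square integrable distributional solutions with the same initial datum coincide: their
difference satisfies the equation with zero datum, and `W = D b(u) z` is dominated by
`(β(u)/u) |z|`. -/
theorem IsLinearizedSolution.ae_eq {d : ℕ} {β b : ℝ → ℝ} {D : Space d → Space d}
    (hβ : ContDiff ℝ 1 β) (hβ' : ∀ r, 0 ≤ deriv β r) (hβ0 : β 0 = 0) (hD : MemLp D ⊤ volume)
    (hb : ContDiff ℝ 1 b)
    (hbβ : ∀ K : Set ℝ, IsCompact K → ∃ α : ℝ, 0 < α ∧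
      ∀ r ∈ K, |deriv b r * r + b r| ≤ α * |deriv β r|)
    {T : ℝ} (hT : 0 < T) {u : ℝ × Space d → ℝ} (hu : MemLp u ⊤ (cylinderMeasure d T))
    {y₁ y₂ : ℝ × Space d → ℝ} (hy₁ : MemLp y₁ 2 (cylinderMeasure d T))
    (hy₂ : MemLp y₂ 2 (cylinderMeasure d T)) {ρ₀ : SignedMeasure (Space d)}
    (hsol₁ : IsLinearizedSolution β b D T u ρ₀ y₁) (hsol₂ : IsLinearizedSolution β b D T u ρ₀ y₂) :
    y₁ =ᵐ[cylinderMeasure d T] y₂ := by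
  set μ := cylinderMeasure d T
  obtain ⟨m, hm, hum⟩ := ae_norm_le_of_memLp_top hu
  obtain ⟨δ, hδ, hDδ⟩ := ae_norm_le_of_memLp_top hD
  obtain ⟨α, hα, hbα⟩ := hbβ (Icc (-m) m) isCompact_Icc
  have hac := continuous_diffusionCoeff hβ hβ0
  obtain ⟨M, hM⟩ := isCompact_Icc.exists_bound_of_continuousOn (s := Icc (-m) m) hac.continuousOn
  obtain ⟨B, hB⟩ := isCompact_Icc.exists_bound_of_continuousOn (s := Icc (-m) m)
    hb.continuous.continuousOn
  have humem : ∀ᵐ p ∂μ, u p ∈ Icc (-m) m := hum.mono fun p hp => abs_le.mp hp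
  have hDμ : ∀ᵐ p ∂μ, ‖D p.2‖ ≤ δ := Measure.quasiMeasurePreserving_snd.ae hDδ
  have hDm : AEStronglyMeasurable (fun p : ℝ × Space d => D p.2) μ := hD.1.comp_snd
  have ham : AEStronglyMeasurable (fun p => diffusionCoeff β (u p)) μ :=
    hac.comp_aestronglyMeasurable hu.1
  have hbm : AEStronglyMeasurable (fun p => b (u p)) μ :=
    hb.continuous.comp_aestronglyMeasurable hu.1
  have haM : ∀ᵐ p ∂μ, ‖diffusionCoeff β (u p)‖ ≤ M := humem.mono fun p hp => hM _ hp
  have hbB : ∀ᵐ p ∂μ, ‖b (u p)‖ ≤ B := humem.mono fun p hp => hB _ hp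
  have hz : MemLp (fun p => y₁ p - y₂ p) 2 μ := hy₁.sub hy₂
  have hmain : (fun p => y₁ p - y₂ p) =ᵐ[μ] 0 := by
    refine ae_eq_zero_of_weak_equation hT (a := fun p => diffusionCoeff β (u p))
      (W := fun p => (b (u p) * (y₁ p - y₂ p)) • D p.2) (M := M) (C := α * δ) hz ?_ ?_ ?_ ?_ ?_
    · refine MemLp.of_le_mul hz (ham.mul hz.1) (c := M) ?_
      filter_upwards [haM] with p hp
      rw [norm_mul]
      gcongr
    · refine MemLp.of_le_mul hz ((hbm.mul hz.1).smul hDm) (c := B * δ) ?_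
      filter_upwards [hbB, hDμ] with p h1 h2
      rw [norm_smul, norm_mul]
      calc ‖b (u p)‖ * ‖y₁ p - y₂ p‖ * ‖D p.2‖ ≤ B * ‖y₁ p - y₂ p‖ * δ := by
            have := (norm_nonneg _).trans h1
            gcongr
        _ = B * δ * ‖y₁ p - y₂ p‖ := by ring
    · filter_upwards [haM] with p hp
      exact ⟨diffusionCoeff_nonneg hβ hβ' hβ0 _, (le_abs_self _).trans hp⟩
    · filter_upwards [humem, hDμ] with p h1 h2
      have h3 := abs_le_mul_diffusionCoeff hβ hβ' hβ0 hb hm hbα h1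
      rw [norm_smul, norm_mul, Real.norm_eq_abs, Real.norm_eq_abs]
      calc |b (u p)| * |y₁ p - y₂ p| * ‖D p.2‖
          ≤ (α * diffusionCoeff β (u p)) * |y₁ p - y₂ p| * δ := by
            have := (abs_nonneg _).trans h3
            gcongr
        _ = _ := by ring
    · intro θ hθ hθc hθs φ hφ
      have htest := isSpaceTimeTestFunction_mul hθ hθc hθs hφ
      -- The three terms of the equation as square integrable functions.
      have hθ2 : MemLp θ 2 (volume.restrict (Ioo 0 T)) :=
        hθ.continuous.memLp_of_hasCompactSupport hθc
      have hθ2' : MemLp (deriv θ) 2 (volume.restrict (Ioo 0 T)) :=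
        (hθ.continuous_deriv (by simp)).memLp_of_hasCompactSupport hθc.deriv
      have hf1 : MemLp (fun p : ℝ × Space d => deriv θ p.1 * φ p.2) 2 μ :=
        memLp_two_smul_prod hθ2' hφ.memLp
      have hk2 : MemLp (fun p : ℝ × Space d => θ p.1 * (Δ φ : Space d → ℝ) p.2) 2 μ :=
        memLp_two_smul_prod hθ2 hφ.laplacian.memLp
      have hk3 : MemLp (fun p : ℝ × Space d => θ p.1 • ∇ φ p.2) 2 μ :=
        memLp_two_smul_prod hθ2 hφ.memLp_gradient
      have hf2 : MemLp (fun p : ℝ × Space d =>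
          diffusionCoeff β (u p) * (θ p.1 * (Δ φ : Space d → ℝ) p.2)) 2 μ := by
        refine MemLp.of_le_mul hk2 (ham.mul hk2.1) (c := M) ?_
        filter_upwards [haM] with p hp
        rw [norm_mul]
        gcongr
      have hf3 : MemLp (fun p : ℝ × Space d =>
          b (u p) * inner ℝ (D p.2) (θ p.1 • ∇ φ p.2)) 2 μ := by
        refine MemLp.of_le_mul hk3 (hbm.mul (hDm.inner hk3.1)) (c := B * δ) ?_
        filter_upwards [hbB, hDμ] with p h1 h2
        rw [norm_mul, mul_assoc]
        have h3 : ‖inner ℝ (D p.2) (θ p.1 • ∇ φ p.2)‖ ≤ δ * ‖θ p.1 • ∇ φ p.2‖ :=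
          (norm_inner_le_norm _ _).trans (by gcongr)
        have := (norm_nonneg _).trans h1
        gcongr
      have hf : MemLp (fun p : ℝ × Space d => deriv θ p.1 * φ p.2
          + diffusionCoeff β (u p) * (θ p.1 * (Δ φ : Space d → ℝ) p.2)
          + b (u p) * inner ℝ (D p.2) (θ p.1 • ∇ φ p.2)) 2 μ := (hf1.add hf2).add hf3
      have hsol : ∀ {y : ℝ × Space d → ℝ}, IsLinearizedSolution β b D T u ρ₀ y →
          (∫ p, (deriv θ p.1 * φ p.2
            + diffusionCoeff β (u p) * (θ p.1 * (Δ φ : Space d → ℝ) p.2)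
            + b (u p) * inner ℝ (D p.2) (θ p.1 • ∇ φ p.2)) * y p ∂μ)
          + (∫ᵛ x, θ 0 * φ x ∂•ρ₀) = 0 := by
        intro y hy
        have h := hy _ htest
        simp only [hφ.laplacian_const_mul, hφ.gradient_const_mul] at h
        refine Eq.trans (congrArg (· + _) ?_) h
        refine integral_congr_ae (.of_forall fun p => ?_)
        simp only
        rw [deriv_mul_const (hθ.differentiable (by simp) _)]
      have h1 := hsol hsol₁
      have h2 := hsol hsol₂
      have hinner : ∀ s t : ℝ, inner ℝ s t = s * t := fun s t => by simp [mul_comm]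
      have hdiff := integral_sub (hf.integrable_mul hy₁) (hf.integrable_mul hy₂)
      simp only [Pi.mul_apply] at hdiff
      have hi1 : Integrable (fun p : ℝ × Space d =>
          deriv θ p.1 * inner ℝ (y₁ p - y₂ p) (φ p.2)) μ :=
        (hf1.integrable_mul hz).congr (.of_forall fun p => by
          simp only [Pi.mul_apply, hinner]
          ring)
      have hi2 : Integrable (fun p : ℝ × Space d => θ p.1 * inner ℝ
          (diffusionCoeff β (u p) * (y₁ p - y₂ p)) ((Δ φ : Space d → ℝ) p.2)) μ :=
        (hf2.integrable_mul hz).congr (.of_forall fun p => by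
          simp only [Pi.mul_apply, hinner]
          ring)
      have hi3 : Integrable (fun p : ℝ × Space d => θ p.1 * inner ℝ
          ((b (u p) * (y₁ p - y₂ p)) • D p.2) (∇ φ p.2)) μ :=
        (hf3.integrable_mul hz).congr (.of_forall fun p => by
          simp only [Pi.mul_apply, real_inner_smul_left, real_inner_smul_right]
          ring)
      have hi12 := hi1.add hi2
      simp only [Pi.add_def] at hi12
      rw [← integral_add hi1 hi2, ← integral_add hi12 hi3]
      refine Eq.trans (integral_congr_ae (.of_forall fun p => ?_))
        (hdiff.trans (sub_eq_zero.mpr (add_right_cancel (h1.trans h2.symm))))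
      simp only [hinner, real_inner_smul_left, real_inner_smul_right]
      ring
  filter_upwards [hmain] with p hp
  exact sub_eq_zero.mp hp

end FokkerPlanck

theorem theorem4p1 (d : ℕ) (hd : 1 ≤ d)
    (β b : ℝ → ℝ) (D : FokkerPlanck.Space d → FokkerPlanck.Space d)
    (hβ : ContDiff ℝ 1 β) (hβ' : ∀ r, 0 ≤ deriv β r) (hβ0 : β 0 = 0)
    (hD : MemLp D ∞ volume)
    (hb : ContDiff ℝ 1 b)
    (hbβ : ∀ K : Set ℝ, IsCompact K → ∃ α : ℝ, 0 < α ∧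
      ∀ r ∈ K, |deriv b r * r + b r| ≤ α * |deriv β r|)
    (T : ℝ) (hT : 0 < T)
    (u : ℝ × FokkerPlanck.Space d → ℝ)
    (hu : MemLp u ∞ (FokkerPlanck.cylinderMeasure d T))
    (y₁ y₂ : ℝ × FokkerPlanck.Space d → ℝ)
    (hy₁ : MemLp y₁ 2 (FokkerPlanck.cylinderMeasure d T))
    (hy₂ : MemLp y₂ 2 (FokkerPlanck.cylinderMeasure d T))
    (hy : FokkerPlanck.MemLinftyHNeg1 T (fun p => y₁ p - y₂ p))
    (ρ₀ : SignedMeasure (FokkerPlanck.Space d))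
    (hsol₁ : FokkerPlanck.IsLinearizedSolution β b D T u ρ₀ y₁)
    (hsol₂ : FokkerPlanck.IsLinearizedSolution β b D T u ρ₀ y₂)
    (hinit : FokkerPlanck.SameInitialValue y₁ y₂) :
    y₁ =ᵐ[FokkerPlanck.cylinderMeasure d T] y₂ :=
  FokkerPlanck.IsLinearizedSolution.ae_eq hβ hβ' hβ0 hD hb hbβ hT hu hy₁ hy₂ hsol₁ hsol₂
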